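/- **Setting.** Let $X,Y$ be real Hilbert spaces, $\mathcal A:D(\mathcal A)\subset X\to X$ a self-adjoint positive operator with compact inverse $\mathcal A^{-1}$, and $\mathcal B:Y\to X$ a bounded operator. Let $(\phi_j)_{j\ge1}$ be an orthonormal basis of $X$ with $\mathcal A\phi_j=\eta_j\phi_j$ and $0<\eta_1\le\eta_2\le\cdots$ (eigenvalues repeated according to multiplicity). Put $V=D(\mathcal A^{1/2})$ with $\|w\|_V=\|\mathcal A^{1/2}w\|_X$, $H=V\times X$, $A(w,v)=(v,-\mathcal Aw)$ with $D(A)=D(\mathcal A)\times V$, and $B^*(w,v)=\mathcal B^*v$. For $\sigma\ge0$ let $X_\sigma=D(\mathcal A^{\sigma})$ with $\|x\|_{X_\sigma}=\|\mathcal A^\sigma x\|_X$, and let $X_{-\sigma}$ be its dual with respect to the inner product of $X$. For $j\ge1$ let $\mu_j=\sqrt{\eta_j}$, $\mu_{-j}=-\sqrt{\eta_j}$, $\phi_{-j}=\phi_j$; for $j\in\mathbb Z^*=\mathbb Z\setminus\{0\}$ let $\varphi_j=\frac1{\sqrt2}\big(\frac1{i\mu_j}\phi_j,\phi_j\big)$,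 so that $A\varphi_j=i\mu_j\varphi_j$ and $B^*\varphi_j=\frac1{\sqrt2}\mathcal B^*\phi_j\in Y$. Let $(\omega_n)_{n\in\mathbb Z}$ be the family $(\mu_j)_{j\in\mathbb Z^*}$ relabelled by $\mathbb Z$ in the same order ($\omega_n=\mu_{n+1}$ for $n\ge0$, $\omega_n=\mu_n$ for $n<0$), and let $b_n=B^*\varphi_j$ for the index $j$ with label $n$. Fix a real number $\beta>-\frac12$. Consider the following two sets of hypotheses. 1. *Uniform gap.* There is $\gamma>0$ with $|\omega_k-\omega_n|\ge\gamma$ for all $k\ne n$, and there is $\theta>0$ with $\|B^*\varphi_j\|_Y\ge\theta\,\mu_j^{-(2\beta+1)}$ for all $j\ge1$. In this case put $T^*=4\pi/\gamma$. 2. *Weak gap.* There is $\gamma_1>0$ with $\omega_{k+2}-\omega_k\ge2\gamma_1$ for all $k\in\mathbb Z$. Let $\mathbb A_1$ be the set of $n\in\mathbb Z$ with $\omega_n-\omega_{n-1}\ge\gamma_1$ and $\omega_{n+1}-\omega_n\ge\gamma_1$, and $\mathbb A_2$ the set of $n\in\mathbb Z$ with $\omega_n-\omega_{n-1}\ge\gamma_1$,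 $\omega_{n+1}-\omega_n<\gamma_1$ and $\omega_{n+2}-\omega_{n+1}\ge\gamma_1$. There is $\theta>0$ such that, for $l=1,2$, all $n\in\mathbb A_l$ and all $\xi\in\mathbb R^l$, $$\|B_n^{-1}\Phi_n\xi\|_{Y,2}\ge\frac{\theta}{|\omega_n|^{2\beta+1}}\|\xi\|_2,$$ where $\|\cdot\|_{Y,2}$ is the Hilbert norm of $Y^l$, and $B_n^{-1}=(1)$, $\Phi_n=(b_n)$ if $l=1$, while $B_n^{-1}=\begin{pmatrix}1&1\\0&\omega_{n+1}-\omega_n\end{pmatrix}$, $\Phi_n=\begin{pmatrix}b_n&0\\0&b_{n+1}\end{pmatrix}$ if $l=2$. In this case put $T^*=4\pi/\gamma_1$. **Lemma 2.1.** Under hypotheses 1, and likewise under hypotheses 2, there is a constant $c>0$ such that, for every $\Delta t>0$ and every solution $(u^k,\tilde u^{k})$ of the scheme $$\frac{\tilde u^{k+1}-u^k}{\Delta t}=A\Big(\frac{u^k+\tilde u^{k+1}}2\Big),\qquad \frac{u^{k+1}-\tilde u^{k+1}}{\Delta t}=(\Delta t)^2A^2u^{k+1}\qquad(k\in\mathbb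 N),\qquad u^0=u_0\in H$$ (with $\frac{u^k+\tilde u^{k+1}}2\in D(A)$ and $u^{k+1}\in D(A^2)$), one has $$c\,\|u^0\|^2_{X_{-\beta}\times X_{-\beta-\frac12}}\le\Delta t\sum_{k\Delta t\in[0,T^*]}\Big\|B^*\Big(\frac{\tilde u^{k+1}+u^k}2\Big)\Big\|_Y^2+\Delta t\sum_{k\Delta t\in[0,T^*]}(\Delta t)^2\|Au^{k+1}\|_H^2+\Delta t\sum_{k\Delta t\in[0,T^*]}(\Delta t)^5\|A^2u^{k+1}\|_H^2 .$$ -/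

import Mathlib

open scoped InnerProductSpace

noncomputable section

namespace TimeDiscreteWave

/-! ### The operator, its eigenbasis and the associated scale of spaces -/

section Spaces

variable {X : Type*} [NormedAddCommGroup X] [InnerProductSpace ℝ X]

/-- The unbounded operator `𝒜` is positive: `⟪𝒜 x, x⟫ > 0` for every nonzero `x ∈ D(𝒜)`. -/
def IsPositiveOp (𝒜 : X →ₗ.[ℝ] X) : Prop :=
  ∀ x : 𝒜.domain, x ≠ 0 → 0 < ⟪𝒜 x, (x : X)⟫_ℝ

/-- `𝒜` is onto and has a compact right inverse `K : X → D(𝒜)`. As a positive operator is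
one-to-one, for such an operator this says that `𝒜⁻¹` exists and is compact in `X`. -/
def HasCompactInverse (𝒜 : X →ₗ.[ℝ] X) : Prop :=
  ∃ K : X →L[ℝ] X, IsCompactOperator K ∧ ∀ x : X, ∃ h : K x ∈ 𝒜.domain, 𝒜 ⟨K x, h⟩ = x

/-- `φ` is an orthonormal basis of `X` made of eigenvectors of `𝒜`, for the eigenvalues `η`,
which are repeated according to multiplicity and listed in nondecreasing order. -/
structure IsEigenbasis (𝒜 : X →ₗ.[ℝ] X) (φ : HilbertBasis ℕ ℝ X) (η : ℕ → ℝ) : Prop where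
  mono : Monotone η
  eigen : ∀ j, ∃ h : φ j ∈ 𝒜.domain, 𝒜 ⟨φ j, h⟩ = η j • φ j

/-- The domain `D(𝒜 ^ s)` of the fractional power of the operator diagonalised by `(φ, η)`. -/
def powDomain (φ : HilbertBasis ℕ ℝ X) (η : ℕ → ℝ) (s : ℝ) : Submodule ℝ X where
  carrier := {x | Summable fun j => (η j ^ s * ⟪φ j, x⟫_ℝ) ^ 2}
  zero_mem' := by simp
  add_mem' := by
    intro x y hx hy
    refine Summable.of_nonneg_of_le (fun j => sq_nonneg _) (fun j => ?_)
      ((hx.add hy).mul_left 2)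
    rw [inner_add_right]
    nlinarith [sq_nonneg (η j ^ s * ⟪φ j, x⟫_ℝ - η j ^ s * ⟪φ j, y⟫_ℝ)]
  smul_mem' := by
    intro c x hx
    refine (hx.mul_left (c ^ 2)).congr (fun j => ?_)
    rw [inner_smul_right]
    ring

/-- `‖𝒜 ^ s x‖_X` for `x ∈ D(𝒜 ^ s)`, where `𝒜 ^ s x = ∑ j, η j ^ s ⟪φ j, x⟫ φ j`
(Parseval). -/
def powNorm (φ : HilbertBasis ℕ ℝ X) (η : ℕ → ℝ) (s : ℝ) (x : X) : ℝ :=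
  √(∑' j, (η j ^ s * ⟪φ j, x⟫_ℝ) ^ 2)

/-- The norm of `x ∈ X` in the dual of `D(𝒜 ^ s)`, `s ≥ 0`, the duality being given by the
inner product of `X`. -/
def dualNorm (φ : HilbertBasis ℕ ℝ X) (η : ℕ → ℝ) (s : ℝ) (x : X) : ℝ :=
  sSup {r | ∃ v ∈ powDomain φ η s, powNorm φ η s v ≤ 1 ∧ r = |⟪x, v⟫_ℝ|}

/-- The norm of the space `X_σ`: this space is `D(𝒜 ^ σ)` if `σ ≥ 0`, and it is the dual of
`D(𝒜 ^ (-σ))` if `σ < 0`. -/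
def scaleNorm (φ : HilbertBasis ℕ ℝ X) (η : ℕ → ℝ) (σ : ℝ) (x : X) : ℝ :=
  if 0 ≤ σ then powNorm φ η σ x else dualNorm φ η (-σ) x

/-- `V = D(𝒜 ^ (1/2))`. -/
def V (φ : HilbertBasis ℕ ℝ X) (η : ℕ → ℝ) : Submodule ℝ X := powDomain φ η (1 / 2)

/-- The energy space `H = V × X`, as a subspace of `X × X`. -/
def energySpace (φ : HilbertBasis ℕ ℝ X) (η : ℕ → ℝ) : Submodule ℝ (X × X) :=
  (V φ η).prod ⊤

/-- The square of the norm of `H = V × X`, where `‖w‖_V = ‖𝒜 ^ (1/2) w‖_X`. -/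
def energyNormSq (φ : HilbertBasis ℕ ℝ X) (η : ℕ → ℝ) (z : X × X) : ℝ :=
  powNorm φ η (1 / 2) z.1 ^ 2 + ‖z.2‖ ^ 2

/-- The square of the norm of `X_{-β} × X_{-β-1/2}`. -/
def weakNormSq (φ : HilbertBasis ℕ ℝ X) (η : ℕ → ℝ) (β : ℝ) (z : X × X) : ℝ :=
  scaleNorm φ η (-β) z.1 ^ 2 + scaleNorm φ η (-β - 1 / 2) z.2 ^ 2

/-! ### The first order operator and the viscous conservative scheme -/

/-- The operator `A (w, v) = (v, -𝒜 w)` with domain `D(A) = D(𝒜) × V`. Its values lie in the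
energy space. -/
def waveOp (𝒜 : X →ₗ.[ℝ] X) (φ : HilbertBasis ℕ ℝ X) (η : ℕ → ℝ) :
    (X × X) →ₗ.[ℝ] (X × X) where
  domain := 𝒜.domain.prod (V φ η)
  toFun :=
    { toFun := fun z => ((z : X × X).2, -𝒜 ⟨(z : X × X).1, z.2.1⟩)
      map_add' := by
        intro z z'
        have h := 𝒜.map_add ⟨(z : X × X).1, z.2.1⟩ ⟨(z' : X × X).1, z'.2.1⟩
        refine Prod.ext rfl ?_
        change -𝒜 (⟨(z : X × X).1, z.2.1⟩ + ⟨(z' : X × X).1, z'.2.1⟩) = _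
        rw [h, neg_add]
        rfl
      map_smul' := by
        intro c z
        have h := 𝒜.map_smul c ⟨(z : X × X).1, z.2.1⟩
        refine Prod.ext rfl ?_
        change -𝒜 (c • ⟨(z : X × X).1, z.2.1⟩) = _
        rw [h, ← smul_neg]
        rfl }

open Classical in
/-- `A z` for `z ∈ D(A)`; the value off the domain is irrelevant. -/
def waveApply (𝒜 : X →ₗ.[ℝ] X) (φ : HilbertBasis ℕ ℝ X) (η : ℕ → ℝ) (z : X × X) : X × X :=
  if h : z ∈ (waveOp 𝒜 φ η).domain then waveOp 𝒜 φ η ⟨z, h⟩ else 0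

/-- `(u, v)`, with `v k` in the role of the intermediate state `ũ^k`, is a solution of the
conservative midpoint scheme with numerical viscosity,
`(ũ^{k+1} - u^k) / Δt = A ((u^k + ũ^{k+1}) / 2)`,
`(u^{k+1} - ũ^{k+1}) / Δt = Δt² A² u^{k+1}`, with initial value `u^0 ∈ H`. -/
structure IsSchemeSolution (𝒜 : X →ₗ.[ℝ] X) (φ : HilbertBasis ℕ ℝ X) (η : ℕ → ℝ) (Δt : ℝ)
    (u v : ℕ → X × X) : Prop where
  init_mem : u 0 ∈ energySpace φ η
  mid_mem : ∀ k, (1 / 2 : ℝ) • (u k + v (k + 1)) ∈ (waveOp 𝒜 φ η).domain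
  mid_eq : ∀ k, (1 / Δt) • (v (k + 1) - u k) =
    waveApply 𝒜 φ η ((1 / 2 : ℝ) • (u k + v (k + 1)))
  next_mem : ∀ k, u (k + 1) ∈ (waveOp 𝒜 φ η).domain
  next_mem_sq : ∀ k, waveApply 𝒜 φ η (u (k + 1)) ∈ (waveOp 𝒜 φ η).domain
  next_eq : ∀ k, (1 / Δt) • (u (k + 1) - v (k + 1)) =
    Δt ^ 2 • waveApply 𝒜 φ η (waveApply 𝒜 φ η (u (k + 1)))

end Spaces

/-! ### Frequencies and gap conditions -/

/-- The frequencies `μ_j`, `j ∈ ℤ \ {0}`, relabelled by `ℤ` in the same order: the index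
`n ≥ 0` stands for `j = n + 1`, where `μ_j = √η_j`, and the index `-(n + 1)` for
`j = -(n + 1)`, where `μ_j = -√η_{-j}` (the eigenvalues `η` are numbered from `0` here). -/
def freq (η : ℕ → ℝ) : ℤ → ℝ
  | Int.ofNat n => √(η n)
  | Int.negSucc n => -√(η n)

/-- The uniform gap condition. -/
def UniformGap (ω : ℤ → ℝ) (γ : ℝ) : Prop := ∀ k n, k ≠ n → γ ≤ |ω k - ω n|

/-- The weak gap condition. -/
def WeakGap (ω : ℤ → ℝ) (γ₁ : ℝ) : Prop := ∀ k, 2 * γ₁ ≤ ω (k + 2) - ω k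

/-- The indices of the isolated frequencies. -/
def clusterOne (ω : ℤ → ℝ) (γ₁ : ℝ) : Set ℤ :=
  {n | γ₁ ≤ ω n - ω (n - 1) ∧ γ₁ ≤ ω (n + 1) - ω n}

/-- The first indices `n` of the pairs `n, n + 1` of close frequencies. -/
def clusterTwo (ω : ℤ → ℝ) (γ₁ : ℝ) : Set ℤ :=
  {n | γ₁ ≤ ω n - ω (n - 1) ∧ ω (n + 1) - ω n < γ₁ ∧ γ₁ ≤ ω (n + 2) - ω (n + 1)}

/-- The matrix `B_n⁻¹` of a cluster of size one. -/
def clusterMatrixOne : Matrix (Fin 1) (Fin 1) ℝ := !![1]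

/-- The matrix `B_n⁻¹` of a cluster of size two. -/
def clusterMatrixTwo (ω : ℤ → ℝ) (n : ℤ) : Matrix (Fin 2) (Fin 2) ℝ :=
  !![1, 1; 0, ω (n + 1) - ω n]

section Observation

variable {X Y : Type*} [NormedAddCommGroup X] [InnerProductSpace ℝ X] [CompleteSpace X]
  [NormedAddCommGroup Y] [InnerProductSpace ℝ Y] [CompleteSpace Y]

/-- The observation operator `B* = (0, 𝓑*)` on pairs. -/
def obs (𝓑 : Y →L[ℝ] X) (z : X × X) : Y := ContinuousLinearMap.adjoint 𝓑 z.2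

/-- The observation `B* φ_j` of the normalised eigenvector
`φ_j = (1/√2) (ϕ_{|j|} / (i μ_j), ϕ_{|j|})` of `A`; only the second component, which is real,
is seen by `B*`. The indices are relabelled by `ℤ` as in `freq`. -/
def modeObs (𝓑 : Y →L[ℝ] X) (φ : HilbertBasis ℕ ℝ X) : ℤ → Y
  | Int.ofNat n => ContinuousLinearMap.adjoint 𝓑 ((1 / √2 : ℝ) • φ n)
  | Int.negSucc n => ContinuousLinearMap.adjoint 𝓑 ((1 / √2 : ℝ) • φ n)

/-- The condition on `B*` that goes with the uniform gap: for some `θ > 0`,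
`‖B* φ_j‖ ≥ θ / μ_j ^ (2β+1)` for all `j ≥ 1`. -/
def ModeBound (𝓑 : Y →L[ℝ] X) (φ : HilbertBasis ℕ ℝ X) (η : ℕ → ℝ) (β : ℝ) : Prop :=
  ∃ θ > 0, ∀ n : ℕ, θ / freq η n ^ (2 * β + 1) ≤ ‖modeObs 𝓑 φ n‖

/-- The norm `‖M Φ ξ‖_{Y,2}`, where `M` is an `l × l` matrix and `Φ` is the diagonal matrix
with the entries `b_1, …, b_l ∈ Y`. -/
def clusterNorm {l : ℕ} (M : Matrix (Fin l) (Fin l) ℝ) (b : Fin l → Y)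
    (ξ : EuclideanSpace ℝ (Fin l)) : ℝ :=
  √(∑ i, ‖∑ j, M i j • ξ j • b j‖ ^ 2)

/-- The condition on `B*` that goes with the weak gap: for some `θ > 0`,
`‖B_n⁻¹ Φ_n ξ‖_{Y,2} ≥ (θ / |μ_n| ^ (2β+1)) ‖ξ‖` for every cluster, of size `l = 1, 2` and
with first index `n`, and for all `ξ ∈ ℝ^l`. -/
def ClusterBound (𝓑 : Y →L[ℝ] X) (φ : HilbertBasis ℕ ℝ X) (η : ℕ → ℝ) (β γ₁ : ℝ) : Prop :=
  ∃ θ > 0,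
    (∀ n ∈ clusterOne (freq η) γ₁, ∀ ξ : EuclideanSpace ℝ (Fin 1),
      θ / |freq η n| ^ (2 * β + 1) * ‖ξ‖ ≤
        clusterNorm clusterMatrixOne ![modeObs 𝓑 φ n] ξ) ∧
    (∀ n ∈ clusterTwo (freq η) γ₁, ∀ ξ : EuclideanSpace ℝ (Fin 2),
      θ / |freq η n| ^ (2 * β + 1) * ‖ξ‖ ≤
        clusterNorm (clusterMatrixTwo (freq η) n) ![modeObs 𝓑 φ n, modeObs 𝓑 φ (n + 1)] ξ)

/-- The weakened observability inequality on `[0, T]`, uniform in the time step: there is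
`c > 0` such that it holds for all `Δt > 0` and all solutions of the scheme. The sums run
over the `k ∈ ℕ` with `k Δt ∈ [0, T]`. -/
def WeakObservability (𝒜 : X →ₗ.[ℝ] X) (φ : HilbertBasis ℕ ℝ X) (η : ℕ → ℝ)
    (𝓑 : Y →L[ℝ] X) (β T : ℝ) : Prop :=
  ∃ c > 0, ∀ Δt > 0, ∀ u v : ℕ → X × X, IsSchemeSolution 𝒜 φ η Δt u v →
    c * weakNormSq φ η β (u 0) ≤
      Δt * ∑ k ∈ Finset.range (⌊T / Δt⌋₊ + 1),
        ‖obs 𝓑 ((1 / 2 : ℝ) • (v (k + 1) + u k))‖ ^ 2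
      + Δt * ∑ k ∈ Finset.range (⌊T / Δt⌋₊ + 1),
        Δt ^ 2 * energyNormSq φ η (waveApply 𝒜 φ η (u (k + 1)))
      + Δt * ∑ k ∈ Finset.range (⌊T / Δt⌋₊ + 1),
        Δt ^ 5 * energyNormSq φ η (waveApply 𝒜 φ η (waveApply 𝒜 φ η (u (k + 1))))

end Observation

end TimeDiscreteWave

end

noncomputable section

namespace TimeDiscreteWave

open MeasureTheory Set

/-! ### The bump function and its correlation kernel -/

/-! The eigenvectors of `A` for the frequencies ±√η_j are merged into one complex coordinate `mode`,
on which `A` is multiplication by i√η_j. A step of the scheme rotates this coordinate by 2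
arctan(√η_j Δt / 2), because the midpoint rule is a Cayley transform, and contracts it by 1/(1 +
x_j), x_j = Δt³ η_j, because of the viscosity (`mode_scheme`). The two viscous sums are, up to a
factor 2, the energy lost by all the modes (`hasSum_dissipation`, `energy_loss_le`).

The spectrum is cut at δ/Δt. Above the cut the damping accumulated over the time T is at least δ²T,
so a fixed fraction of the energy is dissipated and the viscous sums pay for these modes
(`high_frequency_le`). Below the cut the damped motion is replaced by the pure rotation; at each
step the error is at most a multiple of the total dissipation (`norm_sq_midpoint_sub_le`), and the
observation is bounded. What remains is to observe the conservative midpoint scheme at low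
frequencies.

This is a discrete Ingham inequality. The kernel `corr` has Fourier transform (9/4 - t²)|ĝ(t)|², g
being the bump, which is nonpositive for |t| ≥ 3/2. Hence the form ∑ corr(λ_m - λ_n)⟨U_n, U_m⟩ is
bounded above by the samples of the exponential sum in the window |t| < 3/2 (`energy_superpose_le`).
From below, `corr` vanishes beyond distance 2π, so λ_{n+2} - λ_n ≥ 2π makes the form tridiagonal,
and completing squares leaves a coefficient `corrGap` on |U_n|² and a coefficient `corr` on |U_n +
U_{n+1}|² (`correlation_sum_ge`, `corr_add_corr_le`). These two squares are the ones that make up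
‖B_n⁻¹ Φ_n ξ‖².

The time T* = 4π/γ₁ comes from the window of length 3 together with the lower bound 3/4 for the
slope of the arctangent at low frequencies. The uniform gap is the case without pairs of close
frequencies. -/

/-- The bump `(1 + cos x) / 2` on `[-π, π]`, extended by zero. -/
def bump : ℝ → ℝ := indicator (Icc (-Real.pi) Real.pi) fun x => (1 + Real.cos x) / 2

/-- The derivative of `bump`. -/
def dbump : ℝ → ℝ := indicator (Icc (-Real.pi) Real.pi) fun x => -Real.sin x / 2

lemma measurable_bump : Measurable bump :=
  Measurable.indicator (by fun_prop) measurableSet_Icc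

lemma measurable_dbump : Measurable dbump :=
  Measurable.indicator (by fun_prop) measurableSet_Icc

lemma abs_bump_le (x : ℝ) : |bump x| ≤ 1 := by
  unfold bump indicator
  split_ifs
  · rw [abs_le]; constructor <;> linarith [Real.neg_one_le_cos x, Real.cos_le_one x]
  · simp

lemma abs_dbump_le (x : ℝ) : |dbump x| ≤ 1 := by
  unfold dbump indicator
  split_ifs
  · rw [abs_le]; constructor <;> linarith [Real.neg_one_le_sin x, Real.sin_le_one x]
  · simp

/-- Since cos(±π) = -1, the profile also vanishes at the endpoints of its closed support. -/
lemma bump_eq_zero {x : ℝ} (hx : Real.pi ≤ |x|) : bump x = 0 := by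
  rcases hx.eq_or_lt with h | h
  · have : Real.cos x = -1 := by rw [← Real.cos_abs, ← h, Real.cos_pi]
    unfold bump indicator
    split_ifs <;> simp [this]
  · exact indicator_of_notMem (by rw [mem_Icc, ← abs_le]; exact not_le.2 h) _

lemma dbump_eq_zero {x : ℝ} (hx : Real.pi ≤ |x|) : dbump x = 0 := by
  rcases hx.eq_or_lt with h | h
  · have : Real.sin x = 0 := by
      rcases abs_cases x with ⟨h', _⟩ | ⟨h', _⟩
      · rw [← h', ← h, Real.sin_pi]
      · rw [← neg_neg x, ← h', ← h, Real.sin_neg, Real.sin_pi, neg_zero]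
    unfold dbump indicator
    split_ifs <;> simp [this]
  · exact indicator_of_notMem (by rw [mem_Icc, ← abs_le]; exact not_le.2 h) _

lemma bump_neg (x : ℝ) : bump (-x) = bump x := by
  by_cases hx : Real.pi ≤ |x|
  · rw [bump_eq_zero hx, bump_eq_zero (by rwa [abs_neg])]
  · have h : |x| ≤ Real.pi := (not_le.1 hx).le
    have h1 : x ∈ Icc (-Real.pi) Real.pi := abs_le.1 h
    have h2 : -x ∈ Icc (-Real.pi) Real.pi := abs_le.1 (by rwa [abs_neg])
    simp [bump, indicator_of_mem h1, indicator_of_mem h2]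

lemma dbump_neg (x : ℝ) : dbump (-x) = -dbump x := by
  by_cases hx : Real.pi ≤ |x|
  · rw [dbump_eq_zero hx, dbump_eq_zero (by rwa [abs_neg]), neg_zero]
  · have h : |x| ≤ Real.pi := (not_le.1 hx).le
    have h1 : x ∈ Icc (-Real.pi) Real.pi := abs_le.1 h
    have h2 : -x ∈ Icc (-Real.pi) Real.pi := abs_le.1 (by rwa [abs_neg])
    simp only [dbump, indicator_of_mem h1, indicator_of_mem h2, Real.sin_neg]
    ring

/-- The integrand of the correlation kernel. -/
def corrIntegrand (d x : ℝ) : ℝ := 9 / 4 * (bump x * bump (x - d)) - dbump x * dbump (x - d)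

/-- The correlation kernel `∫ (9/4 · bump x · bump (x - d) - bump' x · bump' (x - d)) dx`. -/
def corr (d : ℝ) : ℝ := ∫ x, corrIntegrand d x

lemma corr_neg (d : ℝ) : corr (-d) = corr d := by
  unfold corr
  rw [← integral_neg_eq_self (corrIntegrand (-d))]
  congr 1
  ext x
  have : -x - -d = -(x - d) := by ring
  simp only [corrIntegrand, this, bump_neg, dbump_neg]
  ring

/-- Both translates are nonzero only on the overlap [d - π, π], where the integrand is a
trigonometric polynomial with an explicit primitive. -/
lemma corr_eq_formula {d : ℝ} (h0 : 0 ≤ d) (h1 : d ≤ 2 * Real.pi) :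
    corr d = ((2 * Real.pi - d) * (9 / 4 + 5 / 8 * Real.cos d) + 23 / 8 * Real.sin d) / 4 := by
  have hI : corrIntegrand d = indicator (Icc (d - Real.pi) Real.pi) fun x =>
      9 / 4 * ((1 + Real.cos x) / 2 * ((1 + Real.cos (x - d)) / 2))
        - (-Real.sin x / 2) * (-Real.sin (x - d) / 2) := by
    ext x
    by_cases hx : x ∈ Icc (d - Real.pi) Real.pi
    · have a : x ∈ Icc (-Real.pi) Real.pi := ⟨by linarith [hx.1], hx.2⟩
      have b : x - d ∈ Icc (-Real.pi) Real.pi := ⟨by linarith [hx.1], by linarith [hx.2]⟩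
      simp only [corrIntegrand, bump, dbump, indicator_of_mem a, indicator_of_mem b,
        indicator_of_mem hx]
    · rw [indicator_of_notMem hx]
      have : x ∉ Icc (-Real.pi) Real.pi ∨ x - d ∉ Icc (-Real.pi) Real.pi := by
        by_contra! h
        exact hx ⟨by linarith [h.2.1], h.1.2⟩
      rcases this with h | h <;> simp [corrIntegrand, bump, dbump, indicator_of_notMem h]
  unfold corr
  rw [hI, integral_indicator measurableSet_Icc, integral_Icc_eq_integral_Ioc,
    ← intervalIntegral.integral_of_le (by linarith)]
  have hderiv : ∀ x ∈ uIcc (d - Real.pi) Real.pi, HasDerivAt (fun x =>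
      9 / 16 * (x + Real.sin x + Real.sin (x - d) + x * Real.cos d / 2 + Real.sin (2 * x - d) / 4)
        - (x * Real.cos d / 2 - Real.sin (2 * x - d) / 4) / 4)
      (9 / 4 * ((1 + Real.cos x) / 2 * ((1 + Real.cos (x - d)) / 2))
        - (-Real.sin x / 2) * (-Real.sin (x - d) / 2)) x := by
    intro x _
    have h2 : HasDerivAt (fun x : ℝ => Real.sin (x - d)) (Real.cos (x - d) * 1) x :=
      ((hasDerivAt_id x).sub_const d).sin
    have h3 : HasDerivAt (fun x : ℝ => Real.sin (2 * x - d)) (Real.cos (2 * x - d) * (2 * 1)) x :=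
      (((hasDerivAt_id x).const_mul 2).sub_const d).sin
    have h4 : HasDerivAt (fun x : ℝ => x * Real.cos d / 2) (1 * Real.cos d / 2) x :=
      ((hasDerivAt_id x).mul_const _).div_const _
    have h := ((((((hasDerivAt_id x).add (Real.hasDerivAt_sin x)).add h2).add h4).add
      (h3.div_const 4)).const_mul (9 / 16)).sub ((h4.sub (h3.div_const 4)).div_const 4)
    refine h.congr_deriv ?_
    have e1 : Real.cos (2 * x - d) = Real.cos x * Real.cos (x - d) - Real.sin x * Real.sin (x - d) := by
      rw [← Real.cos_add]; ring_nf
    have e2 : Real.cos d = Real.cos x * Real.cos (x - d) + Real.sin x * Real.sin (x - d) := by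
      rw [← Real.cos_sub]; ring_nf
    rw [e1, e2]
    ring
  rw [intervalIntegral.integral_eq_sub_of_hasDerivAt hderiv
    (Continuous.intervalIntegrable (by fun_prop) _ _)]
  have e1 : Real.sin (Real.pi - d) = Real.sin d := Real.sin_pi_sub d
  have e2 : Real.sin (2 * Real.pi - d) = -Real.sin d := Real.sin_two_pi_sub d
  have e3 : Real.sin (d - Real.pi) = -Real.sin d := Real.sin_sub_pi d
  have e4 : Real.sin (d - Real.pi - d) = 0 := by
    rw [show d - Real.pi - d = -Real.pi by ring, Real.sin_neg, Real.sin_pi, neg_zero]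
  have e5 : Real.sin (2 * (d - Real.pi) - d) = Real.sin d := by
    rw [show 2 * (d - Real.pi) - d = d - 2 * Real.pi by ring, Real.sin_sub_two_pi]
  rw [e1, e2, e3, e4, e5, Real.sin_pi]
  ring

lemma corr_eq_zero {d : ℝ} (hd : 2 * Real.pi ≤ |d|) : corr d = 0 := by
  wlog h0 : 0 ≤ d generalizing d
  · rw [← corr_neg]
    exact this (by rwa [abs_neg]) (by linarith)
  rw [abs_of_nonneg h0] at hd
  rcases hd.eq_or_lt with rfl | hd
  · rw [corr_eq_formula h0 le_rfl]; simp
  · have : corrIntegrand d = 0 := by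
      ext x
      have : Real.pi < |x| ∨ Real.pi < |x - d| := by
        by_contra! h
        linarith [(abs_le.1 h.1).2, (abs_le.1 h.2).1]
      rcases this with h | h <;> simp [corrIntegrand, bump_eq_zero h.le, dbump_eq_zero h.le]
    simp [corr, this]

lemma corr_zero : corr 0 = 23 * Real.pi / 16 := by
  rw [corr_eq_formula le_rfl (by positivity), Real.cos_zero, Real.sin_zero]; ring

lemma corr_pi : corr Real.pi = 13 * Real.pi / 32 := by
  rw [corr_eq_formula Real.pi_pos.le (by linarith [Real.pi_pos]), Real.cos_pi, Real.sin_pi]; ring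

/-! ### Monotonicity of the kernel and the gap inequality. -/

lemma mul_sin_le_two_mul_one_sub_cos {y : ℝ} (h0 : 0 ≤ y) (h1 : y ≤ 2 * Real.pi) :
    y * Real.sin y ≤ 2 * (1 - Real.cos y) := by
  have hs : Real.sin y = 2 * Real.sin (y / 2) * Real.cos (y / 2) := by
    rw [← Real.sin_two_mul]; ring_nf
  have hc : Real.cos y = 1 - 2 * Real.sin (y / 2) ^ 2 := by
    have := Real.cos_two_mul (y / 2)
    rw [show 2 * (y / 2) = y by ring] at this
    rw [this, Real.cos_sq']; ring
  have hsin : 0 ≤ Real.sin (y / 2) := Real.sin_nonneg_of_nonneg_of_le_pi (by linarith) (by linarith)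
  -- Below π/2 this is s ≤ tan s with s = y/2; beyond π/2 the cosine is nonpositive and the sine
  -- nonnegative.
  have key : y / 2 * Real.cos (y / 2) ≤ Real.sin (y / 2) := by
    rcases lt_or_ge (y / 2) (Real.pi / 2) with h | h
    · have hcos : 0 < Real.cos (y / 2) := Real.cos_pos_of_mem_Ioo ⟨by linarith, h⟩
      have := Real.le_tan (by linarith : 0 ≤ y / 2) h
      rwa [Real.tan_eq_sin_div_cos, le_div_iff₀ hcos] at this
    · have hcos : Real.cos (y / 2) ≤ 0 :=
        Real.cos_nonpos_of_pi_div_two_le_of_le h (by linarith [Real.pi_pos])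
      nlinarith
  rw [hs, hc]
  nlinarith [mul_le_mul_of_nonneg_left key hsin]

/-- With y = 2π - d, four times the derivative is -9/4 (1 - cos y) + 5/8 y sin y, and y sin y ≤ 2(1
- cos y) makes it at most -(1 - cos y). -/
lemma corr_antitone_aux : AntitoneOn (fun d =>
    ((2 * Real.pi - d) * (9 / 4 + 5 / 8 * Real.cos d) + 23 / 8 * Real.sin d) / 4)
    (Icc 0 (2 * Real.pi)) := by
  refine antitoneOn_of_hasDerivWithinAt_nonpos (convex_Icc _ _) (by fun_prop)
    (f' := fun d => ((0 - 1) * (9 / 4 + 5 / 8 * Real.cos d)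
      + (2 * Real.pi - d) * (5 / 8 * -Real.sin d) + 23 / 8 * Real.cos d) / 4) ?_ ?_
  · intro d _
    have h1 : HasDerivAt (fun d : ℝ => 2 * Real.pi - d) (0 - 1) d :=
      (hasDerivAt_const d _).sub (hasDerivAt_id d)
    have h2 : HasDerivAt (fun d : ℝ => 9 / 4 + 5 / 8 * Real.cos d) (5 / 8 * -Real.sin d) d :=
      ((Real.hasDerivAt_cos d).const_mul _).const_add _
    exact (((h1.mul h2).add ((Real.hasDerivAt_sin d).const_mul _)).div_const 4).hasDerivWithinAt
  · intro d hd
    rw [interior_Icc] at hd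
    have h := mul_sin_le_two_mul_one_sub_cos (y := 2 * Real.pi - d) (by linarith [hd.2])
      (by linarith [hd.1])
    rw [Real.sin_two_pi_sub, Real.cos_two_pi_sub] at h
    nlinarith [Real.cos_le_one d]

lemma corr_antitone {d d' : ℝ} (h0 : 0 ≤ d) (h : d ≤ d') : corr d' ≤ corr d := by
  rcases le_total d' (2 * Real.pi) with h1 | h1
  · rw [corr_eq_formula h0 (h.trans h1), corr_eq_formula (h0.trans h) h1]
    exact corr_antitone_aux ⟨h0, h.trans h1⟩ ⟨h0.trans h, h1⟩ h
  · rw [corr_eq_zero (h1.trans (le_abs_self _))]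
    rcases le_total d (2 * Real.pi) with h2 | h2
    · rw [← corr_eq_zero (le_abs_self (2 * Real.pi)), corr_eq_formula h0 h2,
        corr_eq_formula (by positivity) le_rfl]
      exact corr_antitone_aux ⟨h0, h2⟩ ⟨by positivity, le_rfl⟩ h2
    · rw [corr_eq_zero (h2.trans (le_abs_self _))]

lemma corr_nonneg (d : ℝ) : 0 ≤ corr d := by
  wlog h0 : 0 ≤ d generalizing d
  · rw [← corr_neg]; exact this _ (by linarith)
  · rw [← corr_eq_zero (d := d + 2 * Real.pi) (by rw [abs_of_nonneg (by positivity)]; linarith)]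
    exact corr_antitone h0 (by linarith [Real.pi_pos])

/-- When d' = 2π - d the sine terms of the closed formula cancel, and the difference equals 5π/16 (1
- cos d). As `corr` decreases, larger distances only help. This gives the diagonal coefficient of a
frequency in terms of its distance to the nearest neighbour; it degenerates quadratically as two
frequencies merge. -/
lemma corr_add_corr_le {d d' e : ℝ} (he0 : 0 ≤ e) (he : e ≤ Real.pi) (hd : e ≤ d) (hd' : e ≤ d')
    (hs : 2 * Real.pi ≤ d + d') : e ^ 2 / 8 ≤ corr 0 - corr d - corr d' := by
  wlog hle : d ≤ d' generalizing d d'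
  · linarith [this hd' hd (by linarith) (le_of_not_ge hle)]
  have hsum : ∀ t, e ≤ t → t ≤ Real.pi → 5 * Real.pi / 16 * (1 - Real.cos e) ≤
      corr 0 - corr t - corr (2 * Real.pi - t) := by
    intro t h1 h2
    rw [corr_zero, corr_eq_formula (by linarith) (by linarith [Real.pi_pos]),
      corr_eq_formula (by linarith [Real.pi_pos]) (by linarith), Real.sin_two_pi_sub,
      Real.cos_two_pi_sub]
    have := Real.cos_le_cos_of_nonneg_of_le_pi he0 h2 h1
    nlinarith [mul_nonneg Real.pi_pos.le (sub_nonneg.2 this)]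
  -- From 1 - cos e ≥ 2e²/π² on [0, π], and 5/(8π) ≥ 1/8.
  have hcos : 5 * Real.pi / 16 * (1 - Real.cos e) ≥ e ^ 2 / 8 := by
    have h := Real.cos_le_one_sub_mul_cos_sq (x := e) (by rwa [abs_of_nonneg he0])
    have h2 : 2 / Real.pi ^ 2 * e ^ 2 ≤ 1 - Real.cos e := by linarith
    have h3 : 5 * Real.pi / 16 * (2 / Real.pi ^ 2 * e ^ 2) ≤ 5 * Real.pi / 16 * (1 - Real.cos e) :=
      mul_le_mul_of_nonneg_left h2 (by positivity)
    have h4 : 5 * Real.pi / 16 * (2 / Real.pi ^ 2 * e ^ 2) = 5 / (8 * Real.pi) * e ^ 2 := by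
      field_simp; ring
    have h5 : 1 / 8 ≤ 5 / (8 * Real.pi) := by
      rw [div_le_div_iff₀ (by norm_num) (by positivity)]
      linarith [Real.pi_le_four]
    nlinarith [sq_nonneg e]
  rcases le_total d Real.pi with h | h
  · have := corr_antitone (by linarith : 0 ≤ 2 * Real.pi - d) (by linarith : 2 * Real.pi - d ≤ d')
    linarith [hsum d hd h]
  -- Both distances are at least π here, so each is compared with the symmetric configuration d = d'
  -- = π.
  · have h1 := corr_antitone Real.pi_pos.le h
    have h2 := corr_antitone Real.pi_pos.le (h.trans hle)
    have h3 := hsum Real.pi he le_rfl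
    rw [show 2 * Real.pi - Real.pi = Real.pi by ring] at h3
    linarith

/-! ### A discrete Ingham inequality -/

/-- A bounded measurable function vanishing outside `(-π, π)`. -/
structure IsProfile (g : ℝ → ℝ) : Prop where
  measurable : Measurable g
  abs_le : ∀ x, |g x| ≤ 1
  eq_zero : ∀ x, Real.pi ≤ |x| → g x = 0

lemma isProfile_bump : IsProfile bump := ⟨measurable_bump, abs_bump_le, fun _ => bump_eq_zero⟩

lemma isProfile_dbump : IsProfile dbump := ⟨measurable_dbump, abs_dbump_le, fun _ => dbump_eq_zero⟩

/-- The superposition of translates of a profile. -/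
def superpose (g : ℝ → ℝ) (s : Finset ℤ) (lam : ℤ → ℝ) (U : ℤ → ℂ) (x : ℝ) : ℂ :=
  ∑ n ∈ s, g (x - lam n) • U n

/-- The Fourier transform of a profile. -/
def profileHat (g : ℝ → ℝ) (t : ℝ) : ℂ :=
  ∫ x : ℝ, Complex.exp (-(t * x * Complex.I)) * g x

/-- The exponential sum `∑ U_n e^{-i λ_n t}`. -/
def expSum (s : Finset ℤ) (lam : ℤ → ℝ) (U : ℤ → ℂ) (t : ℝ) : ℂ :=
  ∑ n ∈ s, Complex.exp (-(t * lam n * Complex.I)) * U n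

/-! ### Parseval for superposed profiles over one period. -/

lemma integrable_of_bounded_of_bounded_support {E : Type*} [NormedAddCommGroup E] {f : ℝ → E}
    (hf : AEStronglyMeasurable f volume) {C r : ℝ} (hC : ∀ x, ‖f x‖ ≤ C)
    (h0 : ∀ x, r < |x| → f x = 0) : Integrable f := by
  refine (integrableOn_iff_integrable_of_support_subset (s := Icc (-r) r) ?_).1 ?_
  · intro x hx
    by_contra h
    rw [mem_Icc, ← _root_.abs_le, not_le] at h
    exact hx (h0 x h)
  · exact Measure.integrableOn_of_bounded (M := C) (by simp) hf
      (Filter.Eventually.of_forall hC)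

lemma IsProfile.measurable_superpose {g : ℝ → ℝ} (hg : IsProfile g) (s : Finset ℤ) (lam : ℤ → ℝ)
    (U : ℤ → ℂ) : Measurable (superpose g s lam U) := by
  unfold superpose
  refine Finset.measurable_fun_sum _ fun n _ => ?_
  exact (hg.measurable.comp (measurable_id.sub_const _)).smul_const _

lemma IsProfile.norm_superpose_le {g : ℝ → ℝ} (hg : IsProfile g) (s : Finset ℤ) (lam : ℤ → ℝ)
    (U : ℤ → ℂ) (x : ℝ) : ‖superpose g s lam U x‖ ≤ ∑ n ∈ s, ‖U n‖ := by
  refine (norm_sum_le _ _).trans (Finset.sum_le_sum fun n _ => ?_)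
  rw [norm_smul]
  exact mul_le_of_le_one_left (norm_nonneg _) (hg.abs_le _)

lemma IsProfile.support_translate {g : ℝ → ℝ} (hg : IsProfile g) {l L : ℝ}
    (hl : |l| + Real.pi ≤ L) {x : ℝ} (hx : g (x - l) ≠ 0) : x ∈ Ioc (-L) L := by
  have h : |x - l| < Real.pi := by
    by_contra h
    exact hx (hg.eq_zero _ (not_lt.1 h))
  have h1 := _root_.abs_lt.1 h
  have h2 := _root_.abs_le.1 (le_refl |l|)
  exact ⟨by linarith, by linarith⟩

lemma IsProfile.integral_translate {g : ℝ → ℝ} (hg : IsProfile g) {l L : ℝ}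
    (hl : |l| + Real.pi ≤ L) (t : ℝ) :
    ∫ x in (-L)..L, Complex.exp (-(t * x * Complex.I)) * g (x - l) =
      Complex.exp (-(t * l * Complex.I)) * profileHat g t := by
  rw [intervalIntegral.integral_eq_integral_of_support_subset]
  · rw [profileHat, ← integral_const_mul,
      ← integral_sub_right_eq_self (fun x : ℝ => Complex.exp (-(t * l * Complex.I)) *
        (Complex.exp (-(t * x * Complex.I)) * g x)) (μ := volume) l]
    congr 1
    ext x
    rw [← mul_assoc, ← Complex.exp_add]
    congr 2
    push_cast
    ring
  · intro x hx
    refine hg.support_translate hl fun h => hx ?_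
    simp [h]

lemma IsProfile.integrable_exp_mul {g : ℝ → ℝ} (hg : IsProfile g) (l t : ℝ) :
    Integrable fun x : ℝ => Complex.exp (-(t * x * Complex.I)) * (g (x - l) : ℂ) := by
  refine integrable_of_bounded_of_bounded_support (C := 1) (r := |l| + Real.pi) ?_ ?_ ?_
  · refine Measurable.aestronglyMeasurable (Measurable.mul (by fun_prop) ?_)
    exact Complex.measurable_ofReal.comp (hg.measurable.comp (measurable_id.sub_const _))
  · intro x
    rw [norm_mul, show -((t : ℂ) * x * Complex.I) = ((-(t * x) : ℝ) : ℂ) * Complex.I by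
      push_cast; ring, Complex.norm_exp_ofReal_mul_I, one_mul, Complex.norm_real]
    exact hg.abs_le _
  · intro x hx
    rw [hg.eq_zero]
    · simp
    · have := abs_sub_abs_le_abs_sub x l
      linarith

/-- All translates fit into one period of length 2π/h, so nothing is lost at the ends: the Fourier
coefficients are exact samples, at the points kh, of the Fourier transform on the line, and a
translate contributes a phase factor. -/
lemma IsProfile.fourierCoeffOn_superpose {g : ℝ → ℝ} (hg : IsProfile g) {s : Finset ℤ}
    {lam : ℤ → ℝ} (U : ℤ → ℂ) {h : ℝ} (hh : 0 < h)
    (hlam : ∀ n ∈ s, |lam n| + Real.pi ≤ Real.pi / h)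
    (hab : -(Real.pi / h) < Real.pi / h) (k : ℤ) :
    fourierCoeffOn hab (superpose g s lam U) k =
      (h / (2 * Real.pi) : ℝ) • (expSum s lam U (k * h) * profileHat g (k * h)) := by
  rw [fourierCoeffOn_eq_integral]
  have e1 : 1 / (Real.pi / h - -(Real.pi / h)) = h / (2 * Real.pi) := by
    field_simp; norm_num
  rw [e1]
  congr 1
  have e2 : ∀ x : ℝ, fourier (-k) (x : AddCircle (Real.pi / h - -(Real.pi / h))) •
      superpose g s lam U x = ∑ n ∈ s, U n * (Complex.exp (-((k * h : ℝ) * x * Complex.I)) *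
        (g (x - lam n) : ℂ)) := by
    intro x
    have e3 : (2 * Real.pi * Complex.I * ((-k : ℤ) : ℂ) * x /
        ((Real.pi / h - -(Real.pi / h) : ℝ) : ℂ)) = -((k * h : ℝ) * x * Complex.I) := by
      have : (h : ℂ) ≠ 0 := by exact_mod_cast hh.ne'
      have hp : (Real.pi : ℂ) ≠ 0 := by exact_mod_cast Real.pi_ne_zero
      push_cast
      field_simp
      ring
    rw [fourier_coe_apply, e3, superpose, smul_eq_mul, Finset.mul_sum]
    refine Finset.sum_congr rfl fun n _ => ?_
    rw [Complex.real_smul]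
    ring
  simp_rw [e2]
  rw [intervalIntegral.integral_finsetSum]
  · rw [expSum, Finset.sum_mul]
    refine Finset.sum_congr rfl fun n hn => ?_
    rw [intervalIntegral.integral_const_mul, hg.integral_translate (hlam n hn)]
    push_cast
    ring
  · intro n _
    exact ((hg.integrable_exp_mul _ _).const_mul _).intervalIntegrable

/-- Parseval's identity on one period; the discrete times kh enter without any aliasing error. -/
lemma IsProfile.hasSum_sq {g : ℝ → ℝ} (hg : IsProfile g) {s : Finset ℤ}
    {lam : ℤ → ℝ} (U : ℤ → ℂ) {h : ℝ} (hh : 0 < h)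
    (hlam : ∀ n ∈ s, |lam n| + Real.pi ≤ Real.pi / h) :
    HasSum (fun k : ℤ => h / (2 * Real.pi) *
        (‖expSum s lam U (k * h)‖ ^ 2 * ‖profileHat g (k * h)‖ ^ 2))
      (∫ x, ‖superpose g s lam U x‖ ^ 2) := by
  have hpos : 0 < Real.pi / h := by positivity
  have hab : -(Real.pi / h) < Real.pi / h := by linarith
  have hL2 : MemLp (superpose g s lam U) 2
      (volume.restrict (Ioc (-(Real.pi / h)) (Real.pi / h))) :=
    MemLp.of_bound (hg.measurable_superpose s lam U).aestronglyMeasurable _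
      (Filter.Eventually.of_forall (hg.norm_superpose_le s lam U))
  have H := (hasSum_sq_fourierCoeffOn hab hL2).mul_left (2 * Real.pi / h)
  have e1 : (Real.pi / h - -(Real.pi / h))⁻¹ = h / (2 * Real.pi) := by
    field_simp; norm_num
  have e2 : ∫ x in (-(Real.pi / h))..(Real.pi / h), ‖superpose g s lam U x‖ ^ 2 =
      ∫ x, ‖superpose g s lam U x‖ ^ 2 := by
    refine intervalIntegral.integral_eq_integral_of_support_subset fun x hx => ?_
    by_contra hmem
    refine hx ?_
    have : superpose g s lam U x = 0 := by
      refine Finset.sum_eq_zero fun n hn => ?_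
      have : g (x - lam n) = 0 := by
        by_contra h0
        exact hmem (hg.support_translate (hlam n hn) h0)
      rw [this, zero_smul]
    simp [this]
  rw [e1, e2, smul_eq_mul, ← mul_assoc, show 2 * Real.pi / h * (h / (2 * Real.pi)) = 1 by
    field_simp, one_mul] at H
  refine H.congr_fun ?_
  intro k
  rw [hg.fourierCoeffOn_superpose U hh hlam, norm_smul, norm_mul, Real.norm_of_nonneg
    (by positivity)]
  field_simp

/-- Integration by parts; the boundary terms vanish because the bump is zero at ±π. -/
lemma profileHat_dbump (t : ℝ) : profileHat dbump t = t * Complex.I * profileHat bump t := by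
  have conv : ∀ f : ℝ → ℝ, profileHat (indicator (Icc (-Real.pi) Real.pi) f) t =
      ∫ x in (-Real.pi)..Real.pi, Complex.exp (-(t * x * Complex.I)) * f x := by
    intro f
    rw [intervalIntegral.integral_of_le (by linarith [Real.pi_pos]),
      ← integral_Icc_eq_integral_Ioc, ← integral_indicator measurableSet_Icc, profileHat]
    congr 1
    ext x
    by_cases hx : x ∈ Icc (-Real.pi) Real.pi <;> simp [hx]
  rw [dbump, bump, conv, conv, ← intervalIntegral.integral_const_mul, ← sub_eq_zero,
    ← intervalIntegral.integral_sub (Continuous.intervalIntegrable (by fun_prop) _ _)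
      (Continuous.intervalIntegrable (by fun_prop) _ _)]
  rw [intervalIntegral.integral_eq_sub_of_hasDerivAt (f := fun x : ℝ =>
    Complex.exp (-(t * x * Complex.I)) * (((1 + Real.cos x) / 2 : ℝ) : ℂ))]
  · simp
  · intro x _
    have h1 : HasDerivAt (fun x : ℝ => Complex.exp (-(t * x * Complex.I)))
        (Complex.exp (-(t * x * Complex.I)) * (-(t * 1 * Complex.I))) x := by
      have : HasDerivAt (fun x : ℝ => (x : ℂ)) 1 x := Complex.ofRealCLM.hasDerivAt
      exact ((this.const_mul _).mul_const _).neg.cexp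
    have h2 : HasDerivAt (fun x : ℝ => (((1 + Real.cos x) / 2 : ℝ) : ℂ))
        ((-Real.sin x / 2 : ℝ) : ℂ) x :=
      (((Real.hasDerivAt_cos x).const_add 1).div_const 2).ofReal_comp
    refine (h1.mul h2).congr_deriv ?_
    ring
  · exact Continuous.intervalIntegrable (by fun_prop) _ _

lemma norm_profileHat_bump_le (t : ℝ) : ‖profileHat bump t‖ ≤ 2 * Real.pi := by
  have e : profileHat bump t =
      ∫ x in (-Real.pi)..Real.pi, Complex.exp (-(t * x * Complex.I)) * (bump (x - 0) : ℂ) := by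
    rw [isProfile_bump.integral_translate (by simp)]; simp
  rw [e]
  refine (intervalIntegral.norm_integral_le_of_norm_le_const (C := 1) fun x _ => ?_).trans ?_
  · rw [norm_mul, show -((t : ℂ) * x * Complex.I) = ((-(t * x) : ℝ) : ℂ) * Complex.I by
      push_cast; ring, Complex.norm_exp_ofReal_mul_I, one_mul, Complex.norm_real]
    exact abs_bump_le _
  · rw [abs_of_nonneg (by linarith [Real.pi_pos])]
    linarith

/-- By Parseval the left side is a sum over k with the weight 9/4 - (kh)², and 9/4 = (3/2)². The
terms with |k| > k₀ are nonpositive and are dropped. In the others the part -(kh)² is discarded and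
|ĝ| ≤ 2π is used, which gives 9/4 · (2π)² / (2π) = 9π/2. -/
lemma energy_superpose_le {s : Finset ℤ} {lam : ℤ → ℝ} (U : ℤ → ℂ) {h : ℝ} (hh : 0 < h)
    (hlam : ∀ n ∈ s, |lam n| + Real.pi ≤ Real.pi / h) {k₀ : ℕ} (hk : 3 / 2 ≤ (k₀ + 1) * h) :
    9 / 4 * (∫ x, ‖superpose bump s lam U x‖ ^ 2) - ∫ x, ‖superpose dbump s lam U x‖ ^ 2 ≤
      9 / 2 * Real.pi * (h * ∑ k ∈ Finset.Icc (-k₀ : ℤ) k₀, ‖expSum s lam U (k * h)‖ ^ 2) := by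
  have H := ((isProfile_bump.hasSum_sq U hh hlam).mul_left (9 / 4)).sub
    (isProfile_dbump.hasSum_sq U hh hlam)
  have hle := sum_le_hasSum (Finset.Icc (-k₀ : ℤ) k₀) (fun k hk' => ?_) H.neg
  · rw [Finset.sum_neg_distrib, neg_le_neg_iff] at hle
    refine hle.trans ?_
    rw [Finset.mul_sum, Finset.mul_sum]
    refine Finset.sum_le_sum fun k _ => ?_
    have h1 : ‖profileHat bump (k * h)‖ ^ 2 ≤ (2 * Real.pi) ^ 2 :=
      pow_le_pow_left₀ (norm_nonneg _) (norm_profileHat_bump_le _) 2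
    have h2 : 0 ≤ h / (2 * Real.pi) * (‖expSum s lam U (k * h)‖ ^ 2 *
      ‖profileHat dbump (k * h)‖ ^ 2) := by positivity
    have h3 : h / (2 * Real.pi) * (‖expSum s lam U (k * h)‖ ^ 2 *
      ‖profileHat bump (k * h)‖ ^ 2) ≤ h / (2 * Real.pi) * (‖expSum s lam U (k * h)‖ ^ 2 *
      (2 * Real.pi) ^ 2) := by gcongr
    have h4 : h / (2 * Real.pi) * (‖expSum s lam U (k * h)‖ ^ 2 *
      (2 * Real.pi) ^ 2) = 2 * Real.pi * (h * ‖expSum s lam U (k * h)‖ ^ 2) := by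
      field_simp
    linarith
  · have hk1 : (k₀ + 1 : ℝ) ≤ |(k : ℝ)| := by
      have : (k₀ : ℤ) + 1 ≤ |k| := by
        by_contra hlt
        exact hk' (Finset.mem_Icc.2 (_root_.abs_le.1 (by omega)))
      exact_mod_cast this
    have hk2 : (3 / 2) ^ 2 ≤ (k * h) ^ 2 := by
      rw [← sq_abs (k * h), abs_mul, abs_of_pos hh]
      exact pow_le_pow_left₀ (by norm_num) (hk.trans (by gcongr)) 2
    have hd : ‖profileHat dbump (k * h)‖ ^ 2 = (k * h) ^ 2 * ‖profileHat bump (k * h)‖ ^ 2 := by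
      rw [profileHat_dbump, norm_mul, norm_mul, Complex.norm_I, Complex.norm_real, mul_one,
        mul_pow, Real.norm_eq_abs, sq_abs]
    rw [hd]
    have : 0 ≤ h / (2 * Real.pi) * (‖expSum s lam U (k * h)‖ ^ 2 *
      ‖profileHat bump (k * h)‖ ^ 2) := by positivity
    nlinarith

/-! ### The correlation form and its lower bound. -/

lemma IsProfile.integrable_mul {g : ℝ → ℝ} (hg : IsProfile g) (a b : ℝ) :
    Integrable fun x => g (x - a) * g (x - b) := by
  refine integrable_of_bounded_of_bounded_support (C := 1) (r := |a| + Real.pi) ?_ ?_ ?_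
  · exact ((hg.measurable.comp (measurable_id.sub_const _)).mul
      (hg.measurable.comp (measurable_id.sub_const _))).aestronglyMeasurable
  · intro x
    rw [norm_mul]
    exact mul_le_one₀ (hg.abs_le _) (norm_nonneg _) (hg.abs_le _)
  · intro x hx
    rw [hg.eq_zero, zero_mul]
    have := abs_sub_abs_le_abs_sub x a
    linarith

lemma IsProfile.integral_norm_sq {g : ℝ → ℝ} (hg : IsProfile g) (s : Finset ℤ) (lam : ℤ → ℝ)
    (U : ℤ → ℂ) : ∫ x, ‖superpose g s lam U x‖ ^ 2 =
      ∑ n ∈ s, ∑ m ∈ s, (∫ x, g (x - lam n) * g (x - lam m)) * ⟪U n, U m⟫_ℝ := by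
  have e : ∀ x, ‖superpose g s lam U x‖ ^ 2 =
      ∑ n ∈ s, ∑ m ∈ s, g (x - lam n) * g (x - lam m) * ⟪U n, U m⟫_ℝ := by
    intro x
    rw [← real_inner_self_eq_norm_sq, superpose, sum_inner]
    refine Finset.sum_congr rfl fun n _ => ?_
    rw [inner_sum]
    refine Finset.sum_congr rfl fun m _ => ?_
    rw [real_inner_smul_left, real_inner_smul_right]
    ring
  simp_rw [e]
  rw [integral_finsetSum]
  · refine Finset.sum_congr rfl fun n _ => ?_
    rw [integral_finsetSum]
    · refine Finset.sum_congr rfl fun m _ => ?_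
      rw [integral_mul_const]
    · intro m _
      exact (hg.integrable_mul _ _).mul_const _
  · intro n _
    exact integrable_finsetSum _ fun m _ => (hg.integrable_mul _ _).mul_const _

lemma energy_superpose_eq (s : Finset ℤ) (lam : ℤ → ℝ) (U : ℤ → ℂ) :
    9 / 4 * (∫ x, ‖superpose bump s lam U x‖ ^ 2) - ∫ x, ‖superpose dbump s lam U x‖ ^ 2 =
      ∑ n ∈ s, ∑ m ∈ s, corr (lam m - lam n) * ⟪U n, U m⟫_ℝ := by
  rw [isProfile_bump.integral_norm_sq, isProfile_dbump.integral_norm_sq, Finset.mul_sum,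
    ← Finset.sum_sub_distrib]
  refine Finset.sum_congr rfl fun n _ => ?_
  rw [Finset.mul_sum, ← Finset.sum_sub_distrib]
  refine Finset.sum_congr rfl fun m _ => ?_
  rw [← mul_assoc, ← sub_mul, ← integral_const_mul, ← integral_sub
    ((isProfile_bump.integrable_mul _ _).const_mul _) (isProfile_dbump.integrable_mul _ _),
    corr, ← integral_sub_right_eq_self (corrIntegrand (lam m - lam n)) (lam n)]
  congr 2
  ext x
  simp only [corrIntegrand, show x - lam n - (lam m - lam n) = x - lam m by ring]

/-- The coefficient of `‖U n‖²` in the diagonal lower bound for the correlation form. -/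
def corrGap (lam : ℤ → ℝ) (n : ℤ) : ℝ :=
  corr 0 - corr (lam (n + 1) - lam n) - corr (lam n - lam (n - 1))

lemma sum_shift_eq {t : Finset ℤ} {f : ℤ → ℝ} (h : ∀ n, n ∉ t ∨ n + 1 ∉ t → f n = 0) :
    ∑ n ∈ t, f (n - 1) = ∑ n ∈ t, f n := by
  have h1 : ∑' n, f n = ∑ n ∈ t, f n := tsum_eq_sum fun n hn => h n (Or.inl hn)
  have h2 : ∑' n, f (n - 1) = ∑ n ∈ t, f (n - 1) :=
    tsum_eq_sum fun n hn => h (n - 1) (Or.inr (by rwa [sub_add_cancel]))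
  rw [← h1, ← h2]
  exact (Equiv.subRight (1 : ℤ)).tsum_eq f

/-- The shift can only lose nonnegative terms at the boundary of `t`. -/
lemma sum_shift_le {t : Finset ℤ} {f : ℤ → ℝ} (h0 : ∀ n, 0 ≤ f n) (h : ∀ n ∉ t, f n = 0) :
    ∑ n ∈ t, f (n + 1) ≤ ∑ n ∈ t, f n := by
  have : ∑ n ∈ t, f (n + 1) = ∑ n ∈ t.map (Equiv.addRight (1 : ℤ)).toEmbedding, f n := by
    rw [Finset.sum_map]; rfl
  rw [this]
  refine (Finset.sum_le_sum_of_subset_of_nonneg (Finset.subset_union_left (s₂ := t))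
    fun n _ _ => h0 n).trans (le_of_eq ?_)
  exact (Finset.sum_subset Finset.subset_union_right fun n _ hn => h n hn).symm

/-- Only neighbouring indices interact, since `corr` vanishes at distances of at least 2π. Each
cross term is rewritten by 2⟨U_n, U_{n+1}⟩ = |U_n + U_{n+1}|² - |U_n|² - |U_{n+1}|²; the subtracted
squares from the two neighbours of n turn corr 0 into `corrGap`. -/
lemma correlation_sum_ge {lam : ℤ → ℝ} (hmono : ∀ n, lam n ≤ lam (n + 1))
    (hgap : ∀ n, 2 * Real.pi ≤ lam (n + 2) - lam n) {t : Finset ℤ} {U : ℤ → ℂ}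
    (hU : ∀ n ∉ t, U n = 0) :
    ∑ n ∈ t, (corrGap lam n * ‖U n‖ ^ 2 + corr (lam (n + 1) - lam n) * ‖U n + U (n + 1)‖ ^ 2) ≤
      ∑ n ∈ t, ∑ m ∈ t, corr (lam m - lam n) * ⟪U n, U m⟫_ℝ := by
  have hmono' : Monotone lam := monotone_int_of_le_succ hmono
  have hfar : ∀ n m : ℤ, n + 2 ≤ m → corr (lam m - lam n) = 0 := by
    intro n m h
    have h1 := hmono' h
    have h2 := hgap n
    exact corr_eq_zero (le_trans (by linarith) (le_abs_self _))
  set g : ℤ → ℝ := fun n => corr (lam (n + 1) - lam n) * ⟪U n, U (n + 1)⟫_ℝ with hg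
  have hinner : ∀ n ∈ t, ∑ m ∈ t, corr (lam m - lam n) * ⟪U n, U m⟫_ℝ =
      corr 0 * ‖U n‖ ^ 2 + g n + g (n - 1) := by
    intro n _
    have h1 : ∑ m ∈ t, corr (lam m - lam n) * ⟪U n, U m⟫_ℝ =
        ∑ m ∈ {n - 1, n, n + 1}, corr (lam m - lam n) * ⟪U n, U m⟫_ℝ := by
      rw [Finset.sum_subset (Finset.subset_union_left (s₁ := t) (s₂ := {n - 1, n, n + 1})),
        Finset.sum_subset (Finset.subset_union_right (s₁ := t) (s₂ := {n - 1, n, n + 1}))]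
      · intro m _ hm
        simp only [Finset.mem_insert, Finset.mem_singleton, not_or] at hm
        rcases lt_or_ge m n with h | h
        · rw [← corr_neg, neg_sub, hfar m n (by omega), zero_mul]
        · rw [hfar n m (by omega), zero_mul]
      · intro m _ hm
        rw [hU m hm, inner_zero_right, mul_zero]
    rw [h1, Finset.sum_insert (by simp; omega), Finset.sum_insert (by simp),
      Finset.sum_singleton, sub_self, real_inner_self_eq_norm_sq]
    simp only [hg, sub_add_cancel]
    rw [real_inner_comm, ← corr_neg, neg_sub]
    ring
  have hr : ∑ n ∈ t, ∑ m ∈ t, corr (lam m - lam n) * ⟪U n, U m⟫_ℝ =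
      ∑ n ∈ t, corr 0 * ‖U n‖ ^ 2 + (∑ n ∈ t, g n + ∑ n ∈ t, g n) := by
    rw [Finset.sum_congr rfl hinner, Finset.sum_add_distrib, Finset.sum_add_distrib,
      sum_shift_eq (f := g), add_assoc]
    rintro n (h | h)
    · simp [hg, hU n h]
    · simp [hg, hU _ h]
  have hg2 : ∀ n, g n = (corr (lam (n + 1) - lam n) * ‖U n + U (n + 1)‖ ^ 2
      - corr (lam (n + 1) - lam n) * ‖U n‖ ^ 2
      - corr (lam (n + 1) - lam n) * ‖U (n + 1)‖ ^ 2) / 2 := by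
    intro n
    rw [norm_add_sq_real]
    simp only [hg]
    ring
  -- Moves the subtracted square of index n + 1 onto index n, where it becomes the contribution of
  -- the left neighbour.
  have hshift := sum_shift_le (t := t) (f := fun n => corr (lam n - lam (n - 1)) * ‖U n‖ ^ 2)
    (fun n => mul_nonneg (corr_nonneg _) (sq_nonneg _)) (fun n hn => by simp [hU n hn])
  simp only [add_sub_cancel_right] at hshift
  have hg3 : ∑ n ∈ t, g n + ∑ n ∈ t, g n = ∑ n ∈ t, corr (lam (n + 1) - lam n) *
      ‖U n + U (n + 1)‖ ^ 2 - ∑ n ∈ t, corr (lam (n + 1) - lam n) * ‖U n‖ ^ 2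
      - ∑ n ∈ t, corr (lam (n + 1) - lam n) * ‖U (n + 1)‖ ^ 2 := by
    rw [← Finset.sum_add_distrib, ← Finset.sum_sub_distrib, ← Finset.sum_sub_distrib]
    refine Finset.sum_congr rfl fun n _ => ?_
    rw [hg2]; ring
  have hl : ∑ n ∈ t, (corrGap lam n * ‖U n‖ ^ 2 +
      corr (lam (n + 1) - lam n) * ‖U n + U (n + 1)‖ ^ 2) =
      ∑ n ∈ t, corr 0 * ‖U n‖ ^ 2 - ∑ n ∈ t, corr (lam (n + 1) - lam n) * ‖U n‖ ^ 2
      - ∑ n ∈ t, corr (lam n - lam (n - 1)) * ‖U n‖ ^ 2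
      + ∑ n ∈ t, corr (lam (n + 1) - lam n) * ‖U n + U (n + 1)‖ ^ 2 := by
    rw [← Finset.sum_sub_distrib, ← Finset.sum_sub_distrib, ← Finset.sum_add_distrib]
    refine Finset.sum_congr rfl fun n _ => ?_
    rw [corrGap]; ring
  rw [hl, hr, hg3]
  linarith

/-- The discrete Ingham inequality under the weak gap condition, for scalar coefficients. -/
lemma ingham_scalar {lam : ℤ → ℝ} (hmono : ∀ n, lam n ≤ lam (n + 1))
    (hgap : ∀ n, 2 * Real.pi ≤ lam (n + 2) - lam n) {s t : Finset ℤ} (hst : s ⊆ t) {U : ℤ → ℂ}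
    (hU : ∀ n ∉ s, U n = 0) {h : ℝ} (hh : 0 < h)
    (hlam : ∀ n ∈ s, |lam n| + Real.pi ≤ Real.pi / h) {k₀ : ℕ} (hk : 3 / 2 ≤ (k₀ + 1) * h) :
    ∑ n ∈ t, (corrGap lam n * ‖U n‖ ^ 2 + corr (lam (n + 1) - lam n) * ‖U n + U (n + 1)‖ ^ 2) ≤
      9 / 2 * Real.pi * (h * ∑ k ∈ Finset.Icc (-k₀ : ℤ) k₀, ‖expSum s lam U (k * h)‖ ^ 2) := by
  refine (correlation_sum_ge hmono hgap fun n hn => hU n fun h => hn (hst h)).trans ?_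
  refine le_trans (le_of_eq ?_) (energy_superpose_le U hh hlam hk)
  rw [energy_superpose_eq, ← Finset.sum_subset hst]
  · refine Finset.sum_congr rfl fun n _ => (Finset.sum_subset hst fun m _ hm => ?_).symm
    rw [hU m hm, inner_zero_right, mul_zero]
  · intro n _ hn
    refine Finset.sum_eq_zero fun m _ => ?_
    rw [hU n hn, inner_zero_left, mul_zero]

/-! ### Coefficients in a real Hilbert space. -/

section Vector

variable {Y : Type*} [NormedAddCommGroup Y] [InnerProductSpace ℝ Y]

/-- The squared norm of `∑ a_n b_n` in the complexification of `Y`. -/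
def cplxNormSq (t : Finset ℤ) (b : ℤ → Y) (a : ℤ → ℂ) : ℝ :=
  ‖∑ n ∈ t, (a n).re • b n‖ ^ 2 + ‖∑ n ∈ t, (a n).im • b n‖ ^ 2

lemma cplxNormSq_nonneg (t : Finset ℤ) (b : ℤ → Y) (a : ℤ → ℂ) : 0 ≤ cplxNormSq t b a := by
  unfold cplxNormSq; positivity

/-- Only finitely many vectors occur, so an orthonormal basis of their span reduces the vector
inequality to a finite sum of scalar ones. -/
lemma exists_coordinates (t : Finset ℤ) (b : ℤ → Y) :
    ∃ (m : ℕ) (e : Fin m → Y), ∀ y ∈ Submodule.span ℝ (b '' t), ∑ i, ⟪e i, y⟫_ℝ ^ 2 = ‖y‖ ^ 2 := by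
  have : FiniteDimensional ℝ (Submodule.span ℝ (b '' t)) :=
    FiniteDimensional.span_of_finite ℝ (t.finite_toSet.image b)
  refine ⟨_, fun i => (stdOrthonormalBasis ℝ (Submodule.span ℝ (b '' t)) i : Y), fun y hy => ?_⟩
  have := (stdOrthonormalBasis ℝ (Submodule.span ℝ (b '' t))).sum_sq_norm_inner_right ⟨y, hy⟩
  simpa using this

lemma sum_coordinates {t : Finset ℤ} {b : ℤ → Y} {m : ℕ} {e : Fin m → Y}
    (he : ∀ y ∈ Submodule.span ℝ (b '' t), ∑ i, ⟪e i, y⟫_ℝ ^ 2 = ‖y‖ ^ 2) {r : Finset ℤ}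
    (hr : r ⊆ t) (a : ℤ → ℂ) :
    ∑ i, ‖∑ n ∈ r, a n * (⟪e i, b n⟫_ℝ : ℂ)‖ ^ 2 = cplxNormSq r b a := by
  have hmem : ∀ c : ℤ → ℝ, ∑ n ∈ r, c n • b n ∈ Submodule.span ℝ (b '' t) := fun c =>
    Submodule.sum_mem _ fun n hn => Submodule.smul_mem _ _
      (Submodule.subset_span ⟨n, hr hn, rfl⟩)
  rw [cplxNormSq, ← he _ (hmem _), ← he _ (hmem _), ← Finset.sum_add_distrib]
  refine Finset.sum_congr rfl fun i _ => ?_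
  rw [← Complex.normSq_eq_norm_sq, Complex.normSq_apply, inner_sum, inner_sum, Complex.re_sum,
    Complex.im_sum]
  simp only [real_inner_smul_right, Complex.mul_re, Complex.mul_im, Complex.ofReal_re,
    Complex.ofReal_im, mul_zero, sub_zero, zero_add]
  ring

/-- The local contribution of the index `n` to the lower bound in the Ingham inequality. -/
def localEnergy (lam : ℤ → ℝ) (b : ℤ → Y) (ξ : ℤ → ℂ) (n : ℤ) : ℝ :=
  corrGap lam n * cplxNormSq {n} b ξ + corr (lam (n + 1) - lam n) * cplxNormSq {n, n + 1} b ξ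

/-- The discrete Ingham inequality under the weak gap condition, for coefficients in a real
Hilbert space. -/
lemma ingham_vector {lam : ℤ → ℝ} (hmono : ∀ n, lam n ≤ lam (n + 1))
    (hgap : ∀ n, 2 * Real.pi ≤ lam (n + 2) - lam n) {s t : Finset ℤ} (hst : s ⊆ t) (b : ℤ → Y)
    {ξ : ℤ → ℂ} (hξ : ∀ n ∉ s, ξ n = 0) {h : ℝ} (hh : 0 < h)
    (hlam : ∀ n ∈ s, |lam n| + Real.pi ≤ Real.pi / h) {k₀ : ℕ} (hk : 3 / 2 ≤ (k₀ + 1) * h) :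
    ∑ n ∈ t, localEnergy lam b ξ n ≤
      9 / 2 * Real.pi * (h * ∑ k ∈ Finset.Icc (-k₀ : ℤ) k₀,
        cplxNormSq s b fun n => Complex.exp (-((k * h : ℝ) * lam n * Complex.I)) * ξ n) := by
  -- The shifted copy of `t` is included because the local energy at n also involves b (n + 1).
  obtain ⟨m, e, he⟩ := exists_coordinates (t ∪ t.image (· + 1)) b
  have hscal := Finset.sum_le_sum fun i (_ : i ∈ (Finset.univ : Finset (Fin m))) =>
    ingham_scalar hmono hgap hst (U := fun n => ξ n * (⟪e i, b n⟫_ℝ : ℂ))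
      (fun n hn => by rw [hξ n hn, zero_mul]) hh hlam hk
  have hl : ∑ n ∈ t, localEnergy lam b ξ n = ∑ i, ∑ n ∈ t, (corrGap lam n *
      ‖ξ n * (⟪e i, b n⟫_ℝ : ℂ)‖ ^ 2 + corr (lam (n + 1) - lam n) *
      ‖ξ n * (⟪e i, b n⟫_ℝ : ℂ) + ξ (n + 1) * (⟪e i, b (n + 1)⟫_ℝ : ℂ)‖ ^ 2) := by
    rw [Finset.sum_comm]
    refine Finset.sum_congr rfl fun n hn => ?_
    have h1 : ({n} : Finset ℤ) ⊆ t ∪ t.image (· + 1) := by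
      intro x hx
      rw [Finset.mem_singleton.1 hx]
      exact Finset.mem_union_left _ hn
    have h2 : ({n, n + 1} : Finset ℤ) ⊆ t ∪ t.image (· + 1) := by
      intro x hx
      rcases Finset.mem_insert.1 hx with rfl | hx
      · exact Finset.mem_union_left _ hn
      · rw [Finset.mem_singleton.1 hx]
        exact Finset.mem_union_right _ (Finset.mem_image_of_mem _ hn)
    rw [localEnergy, ← sum_coordinates he h1, ← sum_coordinates he h2, Finset.sum_add_distrib,
      Finset.mul_sum, Finset.mul_sum]
    simp only [Finset.sum_singleton, Finset.sum_pair (show n ≠ n + 1 by omega)]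
  rw [hl]
  refine hscal.trans (le_of_eq ?_)
  rw [← Finset.mul_sum, ← Finset.mul_sum, Finset.sum_comm]
  congr 3
  ext k
  rw [← sum_coordinates he (hst.trans Finset.subset_union_left)]
  refine Finset.sum_congr rfl fun i _ => ?_
  simp only [expSum, mul_assoc, Complex.ofReal_mul, Complex.ofReal_intCast]

lemma cplxNormSq_singleton (b : ℤ → Y) (ξ : ℤ → ℂ) (n : ℤ) :
    cplxNormSq {n} b ξ = ‖ξ n‖ ^ 2 * ‖b n‖ ^ 2 := by
  rw [cplxNormSq, Finset.sum_singleton, Finset.sum_singleton, norm_smul, norm_smul, mul_pow,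
    mul_pow, Real.norm_eq_abs, Real.norm_eq_abs, sq_abs, sq_abs, ← Complex.normSq_eq_norm_sq,
    Complex.normSq_apply]
  ring

lemma cplxNormSq_pair_le (b : ℤ → Y) (ξ : ℤ → ℂ) (n : ℤ) :
    cplxNormSq {n, n + 1} b ξ ≤ 2 * (cplxNormSq {n} b ξ + cplxNormSq {n + 1} b ξ) := by
  have h : ∀ x y : Y, ‖x + y‖ ^ 2 ≤ 2 * (‖x‖ ^ 2 + ‖y‖ ^ 2) := by
    intro x y
    have := parallelogram_law_with_norm ℝ x y
    nlinarith [mul_self_nonneg ‖x - y‖]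
  simp only [cplxNormSq, Finset.sum_pair (show n ≠ n + 1 by omega), Finset.sum_singleton]
  linarith [h ((ξ n).re • b n) ((ξ (n + 1)).re • b (n + 1)),
    h ((ξ n).im • b n) ((ξ (n + 1)).im • b (n + 1))]

lemma corrGap_nonneg {lam : ℤ → ℝ} (hmono : ∀ n, lam n ≤ lam (n + 1))
    (hgap : ∀ n, 2 * Real.pi ≤ lam (n + 2) - lam n) (n : ℤ) : 0 ≤ corrGap lam n := by
  have h1 := hmono n
  have h2 := hmono (n - 1)
  have h3 := hgap (n - 1)
  rw [show n - 1 + 1 = n by ring] at h2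
  rw [show n - 1 + 2 = n + 1 by ring] at h3
  have := corr_add_corr_le le_rfl Real.pi_pos.le (by linarith : 0 ≤ lam (n + 1) - lam n)
    (by linarith : 0 ≤ lam n - lam (n - 1)) (by linarith)
  simpa [corrGap] using this

lemma corrGap_ge {lam : ℤ → ℝ} (hgap : ∀ n, 2 * Real.pi ≤ lam (n + 2) - lam n) {n : ℤ} {e : ℝ}
    (he0 : 0 ≤ e) (he : e ≤ Real.pi) (h1 : e ≤ lam (n + 1) - lam n)
    (h2 : e ≤ lam n - lam (n - 1)) : e ^ 2 / 8 ≤ corrGap lam n := by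
  have h3 := hgap (n - 1)
  rw [show n - 1 + 2 = n + 1 by ring] at h3
  exact corr_add_corr_le he0 he h1 h2 (by linarith)

lemma localEnergy_nonneg {lam : ℤ → ℝ} (hmono : ∀ n, lam n ≤ lam (n + 1))
    (hgap : ∀ n, 2 * Real.pi ≤ lam (n + 2) - lam n) (b : ℤ → Y) (ξ : ℤ → ℂ) (n : ℤ) :
    0 ≤ localEnergy lam b ξ n :=
  add_nonneg (mul_nonneg (corrGap_nonneg hmono hgap n) (cplxNormSq_nonneg _ _ _))
    (mul_nonneg (corr_nonneg _) (cplxNormSq_nonneg _ _ _))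

lemma localEnergy_ge_of_isolated {lam : ℤ → ℝ}
    (hgap : ∀ n, 2 * Real.pi ≤ lam (n + 2) - lam n) (b : ℤ → Y) (ξ : ℤ → ℂ) {n : ℤ}
    (h1 : Real.pi ≤ lam (n + 1) - lam n) (h2 : Real.pi ≤ lam n - lam (n - 1)) :
    cplxNormSq {n} b ξ ≤ localEnergy lam b ξ n := by
  have h := corrGap_ge hgap Real.pi_pos.le le_rfl h1 h2
  -- π²/8 ≥ 1.
  have h3 : 1 ≤ corrGap lam n := by nlinarith [Real.pi_gt_three]
  have h4 : 0 ≤ corr (lam (n + 1) - lam n) * cplxNormSq {n, n + 1} b ξ :=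
    mul_nonneg (corr_nonneg _) (cplxNormSq_nonneg _ _ _)
  rw [localEnergy]
  nlinarith [cplxNormSq_nonneg {n} b ξ]

/-- For close frequencies the sum of the two terms is seen through `corr` ≥ corr π = 13π/32 ≥ 1, and
the second term alone through `corrGap` ≥ (πD)²/8 ≥ D². The left side is therefore the cluster norm,
with D the normalised distance within the pair. -/
lemma localEnergy_pair_ge {lam : ℤ → ℝ} (hmono : ∀ n, lam n ≤ lam (n + 1))
    (hgap : ∀ n, 2 * Real.pi ≤ lam (n + 2) - lam n) (b : ℤ → Y) (ξ : ℤ → ℂ) {n : ℤ} {D : ℝ}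
    (hD0 : 0 ≤ D) (hD : D ≤ 1)
    (h1 : Real.pi ≤ lam n - lam (n - 1)) (h2 : Real.pi * D ≤ lam (n + 1) - lam n)
    (h3 : Real.pi ≤ lam (n + 2) - lam (n + 1)) :
    cplxNormSq {n, n + 1} b ξ + D ^ 2 * cplxNormSq {n + 1} b ξ ≤
      3 * (localEnergy lam b ξ n + localEnergy lam b ξ (n + 1)) := by
  have hpi := Real.pi_gt_three
  have hle : Real.pi * D ≤ Real.pi := by nlinarith
  have hge : ∀ e, 0 ≤ e → e ≤ Real.pi → e ≤ lam (n + 1) - lam n →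
      e ^ 2 / 8 ≤ corrGap lam n ∧ e ^ 2 / 8 ≤ corrGap lam (n + 1) := by
    intro e he0 he he'
    refine ⟨corrGap_ge hgap he0 he he' (by linarith), corrGap_ge hgap he0 he ?_ ?_⟩
    · rw [show n + 1 + 1 = n + 2 by ring]; linarith
    · rwa [show n + 1 - 1 = n by ring]
  have p1 := cplxNormSq_nonneg {n} b ξ
  have p2 := cplxNormSq_nonneg {n + 1} b ξ
  have p3 := cplxNormSq_nonneg {n, n + 1} b ξ
  have p4 : 0 ≤ corr (lam (n + 1 + 1) - lam (n + 1)) * cplxNormSq {n + 1, n + 1 + 1} b ξ :=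
    mul_nonneg (corr_nonneg _) (cplxNormSq_nonneg _ _ _)
  have p5 : 0 ≤ corr (lam (n + 1) - lam n) * cplxNormSq {n, n + 1} b ξ :=
    mul_nonneg (corr_nonneg _) p3
  have p6 : 0 ≤ corrGap lam n * cplxNormSq {n} b ξ :=
    mul_nonneg (corrGap_nonneg hmono hgap n) p1
  -- The hypotheses bound the gap inside the pair from below only. If it exceeds π, both indices are
  -- isolated and the pair is estimated by twice the sum of its members; together with D² ≤ 1 this
  -- gives the constant 3.
  rcases le_total (lam (n + 1) - lam n) Real.pi with h | h
  · have hc : 1 ≤ corr (lam (n + 1) - lam n) := by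
      have := corr_antitone (by linarith [hmono n]) h
      rw [corr_pi] at this
      linarith
    have hg := (hge _ (by positivity) hle h2).2
    have hg' : D ^ 2 ≤ corrGap lam (n + 1) := by
      have : 8 ≤ Real.pi ^ 2 := by nlinarith
      nlinarith [mul_le_mul_of_nonneg_right this (sq_nonneg D)]
    have q1 := mul_le_mul_of_nonneg_right hg' p2
    have q2 := mul_le_mul_of_nonneg_right hc p3
    have q3 : 0 ≤ D ^ 2 * cplxNormSq {n + 1} b ξ := by positivity
    simp only [localEnergy]
    linarith
  · obtain ⟨hg1, hg2⟩ := hge _ Real.pi_pos.le le_rfl h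
    have hg1' : 1 ≤ corrGap lam n := by nlinarith
    have hg2' : 1 ≤ corrGap lam (n + 1) := by nlinarith
    have q1 := mul_le_mul_of_nonneg_right hg1' p1
    have q2 := mul_le_mul_of_nonneg_right hg2' p2
    have q3 : D ^ 2 * cplxNormSq {n + 1} b ξ ≤ cplxNormSq {n + 1} b ξ :=
      mul_le_of_le_one_left p2 (pow_le_one₀ hD0 hD)
    have q4 := cplxNormSq_pair_le b ξ n
    simp only [localEnergy]
    linarith

end Vector

/-! ### Clusters of frequencies -/

lemma freq_natCast (η : ℕ → ℝ) (n : ℕ) : freq η (n : ℤ) = √(η n) := rfl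

lemma freq_negSucc (η : ℕ → ℝ) (n : ℕ) : freq η (Int.negSucc n) = -√(η n) := rfl

lemma freq_le_succ {η : ℕ → ℝ} (hη : Monotone η) (n : ℤ) : freq η n ≤ freq η (n + 1) := by
  rcases n with n | n
  · exact Real.sqrt_le_sqrt (hη n.le_succ)
  · rcases n with _ | n
    · change -√(η 0) ≤ √(η 0)
      linarith [Real.sqrt_nonneg (η 0)]
    · change -√(η (n + 1)) ≤ -√(η n)
      exact neg_le_neg (Real.sqrt_le_sqrt (hη n.le_succ))

lemma abs_freq_pred_le {η : ℕ → ℝ} (hη : Monotone η) (n : ℕ) :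
    |freq η ((n : ℤ) - 1)| ≤ √(η n) := by
  rcases n with _ | n
  · change |-√(η 0)| ≤ √(η 0)
    rw [abs_neg, abs_of_nonneg (Real.sqrt_nonneg _)]
  · rw [show ((n + 1 : ℕ) : ℤ) - 1 = (n : ℤ) by push_cast; ring, freq_natCast,
      abs_of_nonneg (Real.sqrt_nonneg _)]
    exact Real.sqrt_le_sqrt (hη n.le_succ)

section Cluster

variable {Y : Type*} [NormedAddCommGroup Y] [InnerProductSpace ℝ Y]

lemma clusterNorm_one_sq (b : Y) (x : ℝ) :
    clusterNorm clusterMatrixOne ![b] (!₂[x]) ^ 2 = ‖x • b‖ ^ 2 := by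
  rw [clusterNorm, Real.sq_sqrt (by positivity)]
  simp [clusterMatrixOne]

lemma clusterNorm_two_sq (ω : ℤ → ℝ) (n : ℤ) (b c : Y) (x y : ℝ) :
    clusterNorm (clusterMatrixTwo ω n) ![b, c] (!₂[x, y]) ^ 2 =
      ‖x • b + y • c‖ ^ 2 + (ω (n + 1) - ω n) ^ 2 * ‖y • c‖ ^ 2 := by
  rw [clusterNorm, Real.sq_sqrt (by positivity)]
  simp [clusterMatrixTwo, Fin.sum_univ_two, norm_smul, mul_pow, sq_abs]

lemma cplx_bound_one {b : ℤ → Y} {n : ℤ} {κ : ℝ} (hκ : 0 ≤ κ)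
    (h : ∀ ξ : EuclideanSpace ℝ (Fin 1), κ * ‖ξ‖ ≤ clusterNorm clusterMatrixOne ![b n] ξ)
    (ξ : ℤ → ℂ) : κ ^ 2 * ‖ξ n‖ ^ 2 ≤ cplxNormSq {n} b ξ := by
  have h1 := h !₂[1]
  have h2 := pow_le_pow_left₀ (by positivity) h1 2
  rw [clusterNorm_one_sq, one_smul, mul_pow, EuclideanSpace.norm_sq_eq] at h2
  simp only [Fin.sum_univ_one, Matrix.cons_val_zero, norm_one, one_pow,
    mul_one] at h2
  rw [cplxNormSq_singleton, mul_comm]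
  exact mul_le_mul_of_nonneg_left h2 (sq_nonneg _)

/-- The cluster hypothesis concerns real vectors; it is applied to the real and imaginary parts
separately. -/
lemma cplx_bound_two {b : ℤ → Y} {ω : ℤ → ℝ} {n : ℤ} {κ : ℝ} (hκ : 0 ≤ κ)
    (h : ∀ ξ : EuclideanSpace ℝ (Fin 2),
      κ * ‖ξ‖ ≤ clusterNorm (clusterMatrixTwo ω n) ![b n, b (n + 1)] ξ)
    (ξ : ℤ → ℂ) : κ ^ 2 * (‖ξ n‖ ^ 2 + ‖ξ (n + 1)‖ ^ 2) ≤
      cplxNormSq {n, n + 1} b ξ + (ω (n + 1) - ω n) ^ 2 * cplxNormSq {n + 1} b ξ := by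
  have key : ∀ x y : ℝ, κ ^ 2 * (x ^ 2 + y ^ 2) ≤
      ‖x • b n + y • b (n + 1)‖ ^ 2 + (ω (n + 1) - ω n) ^ 2 * ‖y • b (n + 1)‖ ^ 2 := by
    intro x y
    have h2 := pow_le_pow_left₀ (by positivity) (h !₂[x, y]) 2
    rw [clusterNorm_two_sq, mul_pow, EuclideanSpace.norm_sq_eq] at h2
    simpa [Fin.sum_univ_two] using h2
  simp only [cplxNormSq, Finset.sum_pair (show n ≠ n + 1 by omega), Finset.sum_singleton]
  rw [← Complex.normSq_eq_norm_sq, ← Complex.normSq_eq_norm_sq, Complex.normSq_apply,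
    Complex.normSq_apply]
  nlinarith [key (ξ n).re (ξ (n + 1)).re, key (ξ n).im (ξ (n + 1)).im]

/-- By the weak gap at most one of the two gaps next to n is below γ₁. So n is isolated, or first or
second in a pair, and the local energies at n - 1, n, n + 1 cover all three cases. Nonnegative
indices suffice, since the coefficients used later are conjugate symmetric. -/
lemma mode_le_localEnergy {η : ℕ → ℝ} (hpos : ∀ n, 0 < η n) (hη : Monotone η) {γ₁ p θ : ℝ}
    (hγ : 0 < γ₁) (hgap : WeakGap (freq η) γ₁) (hp : 0 ≤ p) (hθ : 0 < θ) {b : ℤ → Y}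
    (h1 : ∀ n ∈ clusterOne (freq η) γ₁, ∀ ξ : EuclideanSpace ℝ (Fin 1),
      θ / |freq η n| ^ p * ‖ξ‖ ≤ clusterNorm clusterMatrixOne ![b n] ξ)
    (h2 : ∀ n ∈ clusterTwo (freq η) γ₁, ∀ ξ : EuclideanSpace ℝ (Fin 2),
      θ / |freq η n| ^ p * ‖ξ‖ ≤ clusterNorm (clusterMatrixTwo (freq η) n) ![b n, b (n + 1)] ξ)
    {lam : ℤ → ℝ}
    (hlam : ∀ n, Real.pi / γ₁ * (freq η (n + 1) - freq η n) ≤ lam (n + 1) - lam n)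
    (hmono : ∀ n, lam n ≤ lam (n + 1)) (hgap' : ∀ n, 2 * Real.pi ≤ lam (n + 2) - lam n)
    (ξ : ℤ → ℂ) (n : ℕ) :
    (1 / √(η n) ^ p) ^ 2 * ‖ξ n‖ ^ 2 ≤ 3 * (1 + γ₁ ^ 2) / θ ^ 2 *
      (localEnergy lam b ξ (n - 1) + localEnergy lam b ξ n + localEnergy lam b ξ (n + 1)) := by
  have L := localEnergy_nonneg hmono hgap' b ξ
  have hfar : ∀ m, γ₁ ≤ freq η (m + 1) - freq η m → Real.pi ≤ lam (m + 1) - lam m := by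
    intro m hm
    refine le_trans ?_ (hlam m)
    rw [div_mul_eq_mul_div, le_div_iff₀ hγ]
    exact mul_le_mul_of_nonneg_left hm Real.pi_pos.le
  have hsq : 0 < √(η n) := Real.sqrt_pos.2 (hpos n)
  -- The hypothesis carries the weight of the first index m of the cluster; since p ≥ 0 and |freq m|
  -- ≤ √η_n, this weight dominates the one at n.
  have conclude : ∀ (x E : ℝ) (m : ℤ), 0 < |freq η m| → |freq η m| ≤ √(η n) → 0 ≤ x →
      (θ / |freq η m| ^ p) ^ 2 * x ≤ 3 * (1 + γ₁ ^ 2) * E →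
      (1 / √(η n) ^ p) ^ 2 * x ≤ 3 * (1 + γ₁ ^ 2) / θ ^ 2 * E := by
    intro x E m hm0 hm hx h
    have hp1 : |freq η m| ^ p ≤ √(η n) ^ p := Real.rpow_le_rpow hm0.le hm hp
    have hp0 : 0 < |freq η m| ^ p := Real.rpow_pos_of_pos hm0 p
    have h3 : (1 / √(η n) ^ p) ^ 2 ≤ (1 / |freq η m| ^ p) ^ 2 :=
      pow_le_pow_left₀ (by positivity) (one_div_le_one_div_of_le hp0 hp1) 2
    have h4 : (θ / |freq η m| ^ p) ^ 2 = θ ^ 2 * (1 / |freq η m| ^ p) ^ 2 := by ring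
    rw [h4] at h
    rw [div_mul_eq_mul_div, le_div_iff₀ (by positivity)]
    nlinarith [mul_le_mul_of_nonneg_right h3 hx, sq_nonneg θ,
      mul_le_mul_of_nonneg_left (mul_le_mul_of_nonneg_right h3 hx) (sq_nonneg θ)]
  have pair : ∀ m ∈ clusterTwo (freq η) γ₁,
      (θ / |freq η m| ^ p) ^ 2 * (‖ξ m‖ ^ 2 + ‖ξ (m + 1)‖ ^ 2) ≤
        3 * (1 + γ₁ ^ 2) * (localEnergy lam b ξ m + localEnergy lam b ξ (m + 1)) := by
    rintro m hm
    have hb := cplx_bound_two (by positivity) (h2 m hm) ξ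
    obtain ⟨g1, g2, g3⟩ := hm
    have hD0 : 0 ≤ freq η (m + 1) - freq η m := sub_nonneg.2 (freq_le_succ hη m)
    have he1 := hfar (m - 1) (by rwa [sub_add_cancel])
    rw [sub_add_cancel] at he1
    have he3 := hfar (m + 1) (by rwa [show m + 1 + 1 = m + 2 by ring])
    rw [show m + 1 + 1 = m + 2 by ring] at he3
    have hE := localEnergy_pair_ge hmono hgap' b ξ (D := (freq η (m + 1) - freq η m) / γ₁)
      (by positivity) ((div_le_one hγ).2 g2.le) he1 ((le_of_eq (by ring)).trans (hlam m)) he3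
    refine hb.trans ?_
    -- The cluster matrix contains the true distance γ₁ D, whence the factor 1 + γ₁².
    have e : (freq η (m + 1) - freq η m) ^ 2 =
        γ₁ ^ 2 * ((freq η (m + 1) - freq η m) / γ₁) ^ 2 := by field_simp
    rw [e]
    have q1 := cplxNormSq_nonneg {m, m + 1} b ξ
    have q2 : 0 ≤ ((freq η (m + 1) - freq η m) / γ₁) ^ 2 * cplxNormSq {m + 1} b ξ :=
      mul_nonneg (sq_nonneg _) (cplxNormSq_nonneg _ _ _)
    nlinarith [sq_nonneg γ₁, mul_nonneg (sq_nonneg γ₁) q1,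
      mul_le_mul_of_nonneg_left hE (by positivity : 0 ≤ 1 + γ₁ ^ 2)]
  have e0 : |freq η (n : ℤ)| = √(η n) := by
    rw [freq_natCast, abs_of_pos hsq]
  have ga := hgap (n - 2)
  have gb := hgap (n - 1)
  have gc := hgap n
  rw [sub_add_cancel] at ga
  rw [show (n : ℤ) - 1 + 2 = n + 1 by ring] at gb
  have h0 := L (n - 1)
  have h00 := L n
  have h000 := L (n + 1)
  rcases lt_or_ge (freq η (n + 1) - freq η n) γ₁ with hb | hb
  · have hm : (n : ℤ) ∈ clusterTwo (freq η) γ₁ := ⟨by linarith, hb, by linarith⟩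
    refine conclude _ _ n (by rw [e0]; exact hsq) e0.le (sq_nonneg _) ?_
    have hp2 := pair n hm
    have : 0 ≤ (θ / |freq η (n : ℤ)| ^ p) ^ 2 * ‖ξ (n + 1)‖ ^ 2 := by positivity
    nlinarith [mul_nonneg (by positivity : 0 ≤ 3 * (1 + γ₁ ^ 2)) h0]
  rcases lt_or_ge (freq η n - freq η (n - 1)) γ₁ with ha | ha
  · have hm : (n : ℤ) - 1 ∈ clusterTwo (freq η) γ₁ := by
      refine ⟨?_, ?_, ?_⟩
      · rw [show (n : ℤ) - 1 - 1 = n - 2 by ring]; linarith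
      · rwa [sub_add_cancel]
      · rw [sub_add_cancel, show (n : ℤ) - 1 + 2 = n + 1 by ring]; exact hb
    -- For n = 0 the partner is the index -1, whose frequency -√η_0 is still nonzero.
    have hne : 0 < |freq η ((n : ℤ) - 1)| := by
      rcases n with _ | n
      · change 0 < |-√(η 0)|
        rw [abs_neg, abs_of_pos hsq]; exact hsq
      · rw [show ((n + 1 : ℕ) : ℤ) - 1 = (n : ℤ) by push_cast; ring, freq_natCast]
        exact abs_pos.2 (Real.sqrt_pos.2 (hpos n)).ne'
    refine conclude _ _ _ hne (abs_freq_pred_le hη n) (sq_nonneg _) ?_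
    have hp2 := pair _ hm
    rw [sub_add_cancel] at hp2
    have : 0 ≤ (θ / |freq η ((n : ℤ) - 1)| ^ p) ^ 2 * ‖ξ (n - 1)‖ ^ 2 := by positivity
    nlinarith [mul_nonneg (by positivity : 0 ≤ 3 * (1 + γ₁ ^ 2)) h000]
  · refine conclude _ _ n (by rw [e0]; exact hsq) e0.le (sq_nonneg _) ?_
    have hb1 := cplx_bound_one (by positivity) (h1 n ⟨ha, hb⟩) ξ
    have he1 := hfar (n - 1) (by rwa [sub_add_cancel])
    rw [sub_add_cancel] at he1
    have hE := localEnergy_ge_of_isolated hgap' b ξ (hfar n hb) he1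
    have q := mul_nonneg (by positivity : 0 ≤ 3 * (1 + γ₁ ^ 2)) h0
    have q' := mul_nonneg (by positivity : 0 ≤ 3 * (1 + γ₁ ^ 2)) h000
    nlinarith [mul_nonneg (sq_nonneg γ₁) h00]

/-- The discrete Ingham inequality for the frequencies `freq η` grouped in clusters. -/
lemma ingham_cluster {η : ℕ → ℝ} (hpos : ∀ n, 0 < η n) (hη : Monotone η) {γ₁ p θ : ℝ}
    (hγ : 0 < γ₁) (hgap : WeakGap (freq η) γ₁) (hp : 0 ≤ p) (hθ : 0 < θ) {b : ℤ → Y}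
    (h1 : ∀ n ∈ clusterOne (freq η) γ₁, ∀ ξ : EuclideanSpace ℝ (Fin 1),
      θ / |freq η n| ^ p * ‖ξ‖ ≤ clusterNorm clusterMatrixOne ![b n] ξ)
    (h2 : ∀ n ∈ clusterTwo (freq η) γ₁, ∀ ξ : EuclideanSpace ℝ (Fin 2),
      θ / |freq η n| ^ p * ‖ξ‖ ≤ clusterNorm (clusterMatrixTwo (freq η) n) ![b n, b (n + 1)] ξ)
    {lam : ℤ → ℝ}
    (hlam : ∀ n, Real.pi / γ₁ * (freq η (n + 1) - freq η n) ≤ lam (n + 1) - lam n)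
    (N : ℕ) {ξ : ℤ → ℂ} (hξ : ∀ n ∉ Finset.Ico (-N : ℤ) N, ξ n = 0) {h : ℝ} (hh : 0 < h)
    (hbd : ∀ n ∈ Finset.Ico (-N : ℤ) N, |lam n| + Real.pi ≤ Real.pi / h) {k₀ : ℕ}
    (hk : 3 / 2 ≤ (k₀ + 1) * h) :
    ∑ n ∈ Finset.range N, (1 / √(η n) ^ p) ^ 2 * ‖ξ n‖ ^ 2 ≤
      3 * (1 + γ₁ ^ 2) / θ ^ 2 * (3 * (9 / 2 * Real.pi *
        (h * ∑ k ∈ Finset.Icc (-k₀ : ℤ) k₀, cplxNormSq (Finset.Ico (-N : ℤ) N) b fun n =>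
          Complex.exp (-((k * h : ℝ) * lam n * Complex.I)) * ξ n))) := by
  have hmono : ∀ n, lam n ≤ lam (n + 1) := by
    intro n
    have := mul_nonneg (div_nonneg Real.pi_pos.le hγ.le) (sub_nonneg.2 (freq_le_succ hη n))
    linarith [hlam n]
  have hgap' : ∀ n, 2 * Real.pi ≤ lam (n + 2) - lam n := by
    intro n
    have e1 := hlam n
    have e2 := hlam (n + 1)
    rw [show n + 1 + 1 = n + 2 by ring] at e2
    have e3 := mul_le_mul_of_nonneg_left (hgap n) (div_nonneg Real.pi_pos.le hγ.le)
    rw [show Real.pi / γ₁ * (2 * γ₁) = 2 * Real.pi by field_simp] at e3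
    linarith
  have L := localEnergy_nonneg hmono hgap' b ξ
  have hI := ingham_vector hmono hgap' (s := Finset.Ico (-N : ℤ) N)
    (t := Finset.Icc (-N - 1 : ℤ) (N + 1))
    (fun n hn => by rw [Finset.mem_Ico] at hn; rw [Finset.mem_Icc]; omega) b hξ hh hbd hk
  refine (Finset.sum_le_sum fun n _ =>
    mode_le_localEnergy hpos hη hγ hgap hp hθ h1 h2 hlam hmono hgap' ξ n).trans ?_
  rw [← Finset.mul_sum]
  refine mul_le_mul_of_nonneg_left ?_ (by positivity)
  -- Three shifted copies of the sum of local energies give the factor 3; the margin of one index on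
  -- each side of the larger interval makes room for the shifts.
  have hsub : ∀ i : ℤ, -1 ≤ i → i ≤ 1 → ∑ n ∈ Finset.range N, localEnergy lam b ξ (n + i) ≤
      ∑ n ∈ Finset.Icc (-N - 1 : ℤ) (N + 1), localEnergy lam b ξ n := by
    intro i hi1 hi2
    have hinj : Function.Injective fun n : ℕ => (n : ℤ) + i := fun a b hab => by
      simpa using hab
    have hmap := Finset.sum_map (Finset.range N) ⟨_, hinj⟩ (localEnergy lam b ξ)
    refine hmap.symm.trans_le ?_
    refine Finset.sum_le_sum_of_subset_of_nonneg ?_ fun n _ _ => L n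
    intro n hn
    obtain ⟨m, hm, rfl⟩ := Finset.mem_map.1 hn
    have := Finset.mem_range.1 hm
    rw [Finset.mem_Icc]
    simp only [Function.Embedding.coeFn_mk]
    omega
  have s1 := hsub (-1) le_rfl (by norm_num)
  have s2 := hsub 0 (by norm_num) (by norm_num)
  have s3 := hsub 1 (by norm_num) le_rfl
  simp only [← sub_eq_add_neg, add_zero] at s1 s2
  rw [Finset.sum_add_distrib, Finset.sum_add_distrib]
  linarith

end Cluster

/-! ### Observability of the low frequencies for the conservative scheme -/

/-- The arctangent on `[-r, r]`, and the identity outside. -/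
def truncArctan (r t : ℝ) : ℝ := if |t| ≤ r then Real.arctan t else t

lemma arctan_sub_ge {u v : ℝ} (hu : -(1 / 2) ≤ u) (huv : u ≤ v) (hv : v ≤ 1 / 2) :
    3 / 4 * (v - u) ≤ Real.arctan v - Real.arctan u := by
  have hm : MonotoneOn (fun t => Real.arctan t - 3 / 4 * t) (Icc (-(1 / 2)) (1 / 2)) := by
    refine monotoneOn_of_hasDerivWithinAt_nonneg (convex_Icc _ _)
      (f' := fun t => 1 / (1 + t ^ 2) - 3 / 4 * 1) ?_ ?_ ?_
    · exact (Real.continuous_arctan.sub (by fun_prop)).continuousOn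
    · intro t _
      exact ((Real.hasDerivAt_arctan t).sub ((hasDerivAt_id t).const_mul _)).hasDerivWithinAt
    · intro t ht
      rw [interior_Icc] at ht
      have : t ^ 2 ≤ 1 / 4 := by nlinarith [ht.1, ht.2]
      rw [sub_nonneg, le_div_iff₀ (by positivity)]
      linarith
  have := hm ⟨hu, huv.trans hv⟩ ⟨hu.trans huv, hv⟩ huv
  simp only at this
  linarith

lemma abs_arctan_le (t : ℝ) : |Real.arctan t| ≤ |t| := by
  have hm : Monotone fun t => t - Real.arctan t := by
    refine monotone_of_hasDerivAt_nonneg (f' := fun t => 1 - 1 / (1 + t ^ 2)) ?_ ?_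
    · intro t
      exact (hasDerivAt_id t).sub (Real.hasDerivAt_arctan t)
    · intro t
      have : 1 / (1 + t ^ 2) ≤ 1 := by
        rw [div_le_one (by positivity)]; nlinarith [sq_nonneg t]
      simpa using this
  have h0 : ∀ t, 0 ≤ t → |Real.arctan t| ≤ |t| := by
    intro t ht
    have := hm ht
    simp only [Real.arctan_zero, sub_zero] at this
    rw [abs_of_nonneg ht, abs_of_nonneg (Real.arctan_nonneg.2 ht)]
    linarith
  rcases le_total 0 t with h | h
  · exact h0 t h
  · have := h0 (-t) (by linarith)
    rwa [Real.arctan_neg, abs_neg, abs_neg] at this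

/-- The Ingham inequality needs the gap for all integers, whereas the arctangent has slope at least
3/4 only near zero. Continuing it by the identity keeps the bound, because |arctan t| ≤ |t| makes
the jumps go in the right direction. -/
lemma truncArctan_sub_ge {r u v : ℝ} (hr : r ≤ 1 / 2) (huv : u ≤ v) :
    3 / 4 * (v - u) ≤ truncArctan r v - truncArctan r u := by
  have hpos : ∀ t, 0 ≤ t → Real.arctan t ≤ t := fun t ht => by
    have := abs_arctan_le t
    rw [abs_of_nonneg ht] at this
    exact (le_abs_self _).trans this
  have hneg : ∀ t, t ≤ 0 → t ≤ Real.arctan t := fun t ht => by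
    have := hpos (-t) (by linarith)
    rw [Real.arctan_neg] at this
    linarith
  unfold truncArctan
  split_ifs with hv hu hu
  · have h1 := abs_le.1 hv
    have h2 := abs_le.1 hu
    exact arctan_sub_ge (by linarith) huv (by linarith)
  · have h1 := abs_le.1 hv
    have hu' : u < -r := by
      by_contra h
      exact hu (abs_le.2 ⟨by linarith, by linarith⟩)
    rcases le_total v 0 with h | h
    · linarith [hneg v h]
    · have := arctan_sub_ge (u := 0) (by norm_num) h (by linarith)
      rw [Real.arctan_zero] at this
      linarith
  · have h1 := abs_le.1 hu
    have hv' : r < v := by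
      by_contra h
      exact hv (abs_le.2 ⟨by linarith, by linarith⟩)
    rcases le_total 0 u with h | h
    · linarith [hpos u h]
    · have := arctan_sub_ge (v := 0) (by linarith) h (by norm_num)
      rw [Real.arctan_zero] at this
      linarith
  · linarith

lemma sum_Ico_neg (N : ℕ) {M : Type*} [AddCommMonoid M] (f : ℤ → M) :
    ∑ n ∈ Finset.Ico (-N : ℤ) N, f n = ∑ j ∈ Finset.range N, (f j + f (Int.negSucc j)) := by
  induction N with
  | zero => simp
  | succ N ih =>
    have e : Finset.Ico (-(N + 1 : ℕ) : ℤ) (N + 1 : ℕ) =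
        insert (N : ℤ) (insert (Int.negSucc N) (Finset.Ico (-N : ℤ) N)) := by
      ext x
      simp only [Finset.mem_insert, Finset.mem_Ico, Int.negSucc_eq]
      push_cast
      omega
    rw [e, Finset.sum_insert, Finset.sum_insert, Finset.sum_range_succ, ih]
    · abel
    · simp only [Finset.mem_Ico, Int.negSucc_eq]; omega
    · simp only [Finset.mem_insert, Finset.mem_Ico, Int.negSucc_eq]; omega

/-- The two-sided family with `c j` at `j ≥ 0` and `conj (c j)` at `-(j + 1)`, for `j < N`. -/
def twoSided (N : ℕ) (c : ℕ → ℂ) : ℤ → ℂ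
  | Int.ofNat j => if j < N then c j else 0
  | Int.negSucc j => if j < N then (starRingEnd ℂ) (c j) else 0

/-- The phase advance of a mode of frequency `√η` over one step of the midpoint scheme. -/
def phase (η Δt : ℝ) : ℝ := 2 * Real.arctan (√η * Δt / 2)

section Low

variable {Y : Type*} [NormedAddCommGroup Y] [InnerProductSpace ℝ Y]

/-- Conjugate coefficients on equal vectors cancel in the imaginary part and double in the real
part, which is what a real solution exhibits. -/
lemma cplxNormSq_twoSided {b : ℤ → Y} (hb : ∀ j, b (Int.negSucc j) = b j) (N : ℕ) (z : ℕ → ℂ)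
    {a : ℤ → ℂ} (ha : ∀ n ∈ Finset.Ico (-N : ℤ) N, a n = twoSided N z n) :
    cplxNormSq (Finset.Ico (-N : ℤ) N) b a =
      4 * ‖∑ j ∈ Finset.range N, (z j).re • b j‖ ^ 2 := by
  have hre : ∑ n ∈ Finset.Ico (-N : ℤ) N, (a n).re • b n =
      (2 : ℝ) • ∑ j ∈ Finset.range N, (z j).re • b j := by
    rw [Finset.sum_congr rfl fun n hn => by rw [ha n hn], sum_Ico_neg, Finset.smul_sum]
    refine Finset.sum_congr rfl fun j hj => ?_
    have hj' := Finset.mem_range.1 hj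
    have e1 : twoSided N z (j : ℤ) = z j := if_pos hj'
    have e2 : twoSided N z (Int.negSucc j) = (starRingEnd ℂ) (z j) := if_pos hj'
    rw [hb, e1, e2, Complex.conj_re, two_smul]
  have him : ∑ n ∈ Finset.Ico (-N : ℤ) N, (a n).im • b n = 0 := by
    rw [Finset.sum_congr rfl fun n hn => by rw [ha n hn], sum_Ico_neg]
    refine Finset.sum_eq_zero fun j hj => ?_
    have hj' := Finset.mem_range.1 hj
    have e1 : twoSided N z (j : ℤ) = z j := if_pos hj'
    have e2 : twoSided N z (Int.negSucc j) = (starRingEnd ℂ) (z j) := if_pos hj'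
    rw [hb, e1, e2, Complex.conj_im, ← add_smul, add_neg_cancel, zero_smul]
  rw [cplxNormSq, hre, him, norm_smul, norm_zero, Real.norm_eq_abs, abs_two]
  ring

/-- Transfers the time window centred at zero, on which the Ingham inequality holds, to the steps 0,
…, 2k₀ of the scheme. -/
lemma sum_Icc_reflect_le {F : ℕ → ℝ} (hF : ∀ k, 0 ≤ F k) {k₀ K : ℕ} (hk : 2 * k₀ ≤ K) :
    ∑ k ∈ Finset.Icc (-k₀ : ℤ) k₀, F (k₀ - k).toNat ≤ ∑ k ∈ Finset.range (K + 1), F k := by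
  have hinj : Set.InjOn (fun k : ℤ => (k₀ - k).toNat) (Finset.Icc (-k₀ : ℤ) k₀) := by
    intro x hx y hy hxy
    rw [Finset.mem_coe, Finset.mem_Icc] at hx hy
    simp only at hxy
    omega
  rw [← Finset.sum_image (f := F) hinj]
  refine Finset.sum_le_sum_of_subset_of_nonneg ?_ fun k _ _ => hF k
  intro k hk'
  obtain ⟨x, hx, rfl⟩ := Finset.mem_image.1 hk'
  rw [Finset.mem_Icc] at hx
  rw [Finset.mem_range]
  omega

/-- Observability of finitely many low frequency modes of the conservative midpoint scheme. -/
lemma low_frequency_observability {η : ℕ → ℝ} (hpos : ∀ n, 0 < η n) (hη : Monotone η)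
    {γ₁ p θ : ℝ} (hγ : 0 < γ₁) (hgap : WeakGap (freq η) γ₁) (hp : 0 ≤ p) (hθ : 0 < θ) {b : ℤ → Y}
    (hb : ∀ j, b (Int.negSucc j) = b j)
    (h1 : ∀ n ∈ clusterOne (freq η) γ₁, ∀ ξ : EuclideanSpace ℝ (Fin 1),
      θ / |freq η n| ^ p * ‖ξ‖ ≤ clusterNorm clusterMatrixOne ![b n] ξ)
    (h2 : ∀ n ∈ clusterTwo (freq η) γ₁, ∀ ξ : EuclideanSpace ℝ (Fin 2),
      θ / |freq η n| ^ p * ‖ξ‖ ≤ clusterNorm (clusterMatrixTwo (freq η) n) ![b n, b (n + 1)] ξ)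
    {Δt : ℝ} (hΔ : 0 < Δt) (hΔγ : γ₁ * Δt ≤ 1) {N : ℕ} (hN : ∀ j < N, √(η j) * Δt ≤ 1)
    (c : ℕ → ℂ) :
    ∑ n ∈ Finset.range N, (1 / √(η n) ^ p) ^ 2 * ‖c n‖ ^ 2 ≤
      3 * (1 + γ₁ ^ 2) / θ ^ 2 * (3 * (9 / 2 * Real.pi * (3 * γ₁ / (4 * Real.pi) * 4))) *
        (Δt * ∑ k ∈ Finset.range (⌊2 * (2 * Real.pi / γ₁) / Δt⌋₊ + 1),
          ‖∑ j ∈ Finset.range N,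
            (Complex.exp ((k * phase (η j) Δt : ℝ) * Complex.I) * c j).re • b j‖ ^ 2) := by
  have hpi := Real.pi_pos
  set K := ⌊2 * (2 * Real.pi / γ₁) / Δt⌋₊ with hK
  set k₀ := K / 2 with hk₀
  set h := 3 * γ₁ / (4 * Real.pi) * Δt with hh
  have hhpos : 0 < h := by positivity
  -- In the time unit of h, half the observation time 2π/γ₁ has length 3/2. The two floors do no
  -- harm, since K + 1 ≤ 2(k₀ + 1).
  have hk : 3 / 2 ≤ ((k₀ : ℝ) + 1) * h := by
    have e1 : 2 * (2 * Real.pi / γ₁) / Δt < K + 1 := Nat.lt_floor_add_one _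
    have e2 : (K : ℝ) + 1 ≤ 2 * (k₀ + 1) := by
      have : K + 1 ≤ 2 * (k₀ + 1) := by omega
      exact_mod_cast this
    have e3 : 2 * (2 * Real.pi / γ₁) / Δt ≤ 2 * (k₀ + 1) := by linarith
    rw [div_le_iff₀ hΔ, mul_div_assoc', div_le_iff₀ hγ] at e3
    rw [hh, ← mul_assoc, ← div_le_iff₀ hΔ]
    rw [div_le_iff₀ hΔ, mul_div_assoc', div_mul_eq_mul_div, le_div_iff₀ (by positivity)]
    nlinarith
  -- The phase per step, 2 arctan(ω_n Δt / 2), divided by h. The slope bound 3/4 compensates the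
  -- factor 3/4 in h, so gaps of ω are multiplied by at least π/γ₁.
  set lam : ℤ → ℝ := fun n =>
    8 * Real.pi / (3 * γ₁ * Δt) * truncArctan (1 / 2) (freq η n * Δt / 2) with hlam
  have hlow : ∀ j < N, |√(η j) * Δt / 2| ≤ 1 / 2 := by
    intro j hj
    rw [abs_of_nonneg (by positivity)]
    linarith [hN j hj]
  have hfreq : ∀ n ∈ Finset.Ico (-N : ℤ) N, |freq η n * Δt / 2| ≤ 1 / 2 := by
    rintro (j | j) hn
    · exact hlow j (Int.ofNat_lt.1 (Finset.mem_Ico.1 hn).2)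
    · rw [freq_negSucc, neg_mul, neg_div, abs_neg]
      exact hlow j (by rw [Finset.mem_Ico] at hn; omega)
  have hlam_gap : ∀ n, Real.pi / γ₁ * (freq η (n + 1) - freq η n) ≤ lam (n + 1) - lam n := by
    intro n
    have hle : freq η n * Δt / 2 ≤ freq η (n + 1) * Δt / 2 := by
      have := freq_le_succ hη n
      gcongr
    have := truncArctan_sub_ge (r := 1 / 2) le_rfl hle
    have h3 := mul_le_mul_of_nonneg_left this
      (by positivity : 0 ≤ 8 * Real.pi / (3 * γ₁ * Δt))
    simp only [hlam]
    rw [← mul_sub]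
    refine le_trans (le_of_eq ?_) h3
    field_simp
    ring
  -- The translates fit in one period: |λ_n| ≤ 4π/(3γ₁Δt), π ≤ 3π/(3γ₁Δt) by γ₁Δt ≤ 1, and 7π ≤ 4π².
  have hbd : ∀ n ∈ Finset.Ico (-N : ℤ) N, |lam n| + Real.pi ≤ Real.pi / h := by
    intro n hn
    have hf := hfreq n hn
    have e1 : |lam n| ≤ 8 * Real.pi / (3 * γ₁ * Δt) * (1 / 2) := by
      simp only [hlam]
      rw [abs_mul, abs_of_pos (by positivity), truncArctan, if_pos hf]
      exact mul_le_mul_of_nonneg_left ((abs_arctan_le _).trans hf) (by positivity)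
    have e2 : Real.pi / h = 4 * Real.pi ^ 2 / (3 * γ₁ * Δt) := by
      rw [hh]; field_simp
    have e3 : Real.pi ≤ Real.pi * 3 / (3 * γ₁ * Δt) := by
      rw [le_div_iff₀ (by positivity)]
      nlinarith
    rw [e2]
    have e4 : 8 * Real.pi / (3 * γ₁ * Δt) * (1 / 2) + Real.pi * 3 / (3 * γ₁ * Δt) =
        (7 * Real.pi) / (3 * γ₁ * Δt) := by ring
    have e5 : (7 * Real.pi) / (3 * γ₁ * Δt) ≤ 4 * Real.pi ^ 2 / (3 * γ₁ * Δt) := by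
      refine div_le_div_of_nonneg_right ?_ (by positivity)
      nlinarith [Real.pi_gt_three]
    linarith
  -- Advancing the data by k₀ steps centres the window; the sample k of the exponential sum is then
  -- the state at step k₀ - k.
  set z : ℕ → ℂ := fun j => Complex.exp ((k₀ * phase (η j) Δt : ℝ) * Complex.I) * c j with hz
  have hξ : ∀ n ∉ Finset.Ico (-N : ℤ) N, twoSided N z n = 0 := by
    rintro (j | j) hn
    · refine if_neg fun hj => hn ?_
      rw [Finset.mem_Ico]
      constructor
      · have := Int.natCast_nonneg j
        simp only [Int.ofNat_eq_natCast]
        omega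
      · simp only [Int.ofNat_eq_natCast]; omega
    · refine if_neg fun hj => hn ?_
      rw [Finset.mem_Ico]
      simp only [Int.negSucc_eq]
      omega
  have hmain := ingham_cluster hpos hη hγ hgap hp hθ h1 h2 hlam_gap N hξ hhpos hbd hk
  have hleft : ∑ n ∈ Finset.range N, (1 / √(η n) ^ p) ^ 2 * ‖twoSided N z n‖ ^ 2 =
      ∑ n ∈ Finset.range N, (1 / √(η n) ^ p) ^ 2 * ‖c n‖ ^ 2 := by
    refine Finset.sum_congr rfl fun n hn => ?_
    have e1 : twoSided N z (n : ℤ) = z n := if_pos (Finset.mem_range.1 hn)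
    rw [e1, hz]
    simp only
    rw [norm_mul, Complex.norm_exp_ofReal_mul_I, one_mul]
  rw [hleft] at hmain
  refine hmain.trans ?_
  set F : ℕ → ℝ := fun k => ‖∑ j ∈ Finset.range N,
    (Complex.exp ((k * phase (η j) Δt : ℝ) * Complex.I) * c j).re • b j‖ ^ 2 with hF
  have hright : ∀ k ∈ Finset.Icc (-k₀ : ℤ) k₀, (cplxNormSq (Finset.Ico (-N : ℤ) N) b fun n =>
      Complex.exp (-((k * h : ℝ) * lam n * Complex.I)) * twoSided N z n) =
      4 * F (k₀ - k).toNat := by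
    intro k hk'
    rw [cplxNormSq_twoSided hb N (fun j =>
      Complex.exp ((((k₀ - k).toNat : ℝ) * phase (η j) Δt : ℝ) * Complex.I) * c j)]
    have hcast : (((k₀ - k).toNat : ℝ)) = (k₀ : ℝ) - k := by
      have : (((k₀ - k).toNat : ℤ)) = (k₀ : ℤ) - k := by
        rw [Int.toNat_of_nonneg]
        linarith [(Finset.mem_Icc.1 hk').2]
      exact_mod_cast congrArg (Int.cast : ℤ → ℝ) this
    have hscale : ∀ n ∈ Finset.Ico (-N : ℤ) N,
        k * h * lam n = k * (2 * Real.arctan (freq η n * Δt / 2)) := by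
      intro n hn
      simp only [hlam, hh]
      rw [truncArctan, if_pos (hfreq n hn)]
      field_simp
      ring
    have hpos_case : ∀ j : ℕ, Complex.exp (-((k * (2 * Real.arctan (√(η j) * Δt / 2)) : ℝ) *
        Complex.I)) * z j =
        Complex.exp ((((k₀ - k).toNat : ℝ) * phase (η j) Δt : ℝ) * Complex.I) * c j := by
      intro j
      simp only [hz, phase]
      rw [← mul_assoc, ← Complex.exp_add, hcast]
      congr 2
      push_cast
      ring
    rintro (j | j) hn
    · have hj : j < N := Int.ofNat_lt.1 (Finset.mem_Ico.1 hn).2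
      rw [← Complex.ofReal_mul, hscale _ hn]
      simp only [twoSided, if_pos hj]
      exact hpos_case j
    · have hj : j < N := by rw [Finset.mem_Ico] at hn; omega
      rw [← Complex.ofReal_mul, hscale _ hn]
      simp only [twoSided, if_pos hj]
      have hconj : ∀ a : ℝ, (starRingEnd ℂ) (Complex.exp (-((a : ℂ) * Complex.I))) =
          Complex.exp (-(((-a : ℝ) : ℂ) * Complex.I)) := by
        intro a
        rw [← Complex.exp_conj, map_neg, map_mul, Complex.conj_I, Complex.conj_ofReal]
        push_cast
        ring_nf
      rw [← hpos_case j, map_mul (starRingEnd ℂ) _ (z j), hconj, freq_negSucc, neg_mul, neg_div, Real.arctan_neg,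
        mul_neg, mul_neg]
  rw [Finset.sum_congr rfl hright, ← Finset.mul_sum]
  have hsum := sum_Icc_reflect_le (F := F) (fun k => by simp only [hF]; positivity)
    (by omega : 2 * k₀ ≤ K)
  have e : 3 * (1 + γ₁ ^ 2) / θ ^ 2 * (3 * (9 / 2 * Real.pi *
      (h * (4 * ∑ k ∈ Finset.Icc (-k₀ : ℤ) k₀, F (k₀ - k).toNat)))) =
      3 * (1 + γ₁ ^ 2) / θ ^ 2 * (3 * (9 / 2 * Real.pi * (3 * γ₁ / (4 * Real.pi) * 4))) *
        (Δt * ∑ k ∈ Finset.Icc (-k₀ : ℤ) k₀, F (k₀ - k).toNat) := by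
    rw [hh]; ring
  rw [e]
  gcongr

end Low

/-! ### The scheme in modal coordinates -/

section Damping

/-- The dissipation, up to the step `K`, of a mode of energy `a` which is damped by the factor
`1 / (1 + x)` in each step. -/
def modeDissipation (K : ℕ) (x a : ℝ) : ℝ :=
  ∑ k ∈ Finset.range (K + 1), (x + x ^ 2) * ((1 / (1 + x)) ^ (2 * (k + 1)) * a)

lemma modeDissipation_nonneg (K : ℕ) {x a : ℝ} (hx : 0 ≤ x) (ha : 0 ≤ a) :
    0 ≤ modeDissipation K x a :=
  Finset.sum_nonneg fun k _ => by positivity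

/-- The energy lost in one step is (2x + x²) times the new energy, hence at most twice the
dissipation of that step; the losses telescope. -/
lemma energy_loss_le {K k : ℕ} (hk : k ≤ K + 1) {x a : ℝ} (hx : 0 ≤ x) (ha : 0 ≤ a) :
    (1 - (1 / (1 + x)) ^ (2 * k)) * a ≤ 2 * modeDissipation K x a := by
  set r := 1 / (1 + x) with hr
  have hr0 : 0 < r := by positivity
  have hrx : r * (1 + x) = 1 := by rw [hr]; field_simp
  have htel : ∑ i ∈ Finset.range k, (r ^ (2 * i) - r ^ (2 * (i + 1))) = 1 - r ^ (2 * k) := by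
    have := Finset.sum_range_sub' (fun i => r ^ (2 * i)) k
    simpa using this
  have hterm : ∀ i, (r ^ (2 * i) - r ^ (2 * (i + 1))) * a ≤
      2 * ((x + x ^ 2) * (r ^ (2 * (i + 1)) * a)) := by
    intro i
    have e : r ^ (2 * i) = (2 * x + x ^ 2 + 1) * r ^ (2 * (i + 1)) := by
      have : (2 * x + x ^ 2 + 1) * r ^ (2 * (i + 1)) = r ^ (2 * i) * (r * (1 + x)) ^ 2 := by ring
      rw [this, hrx, one_pow, mul_one]
    have hp : 0 ≤ r ^ (2 * (i + 1)) * a := by positivity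
    rw [e]
    nlinarith [mul_nonneg (sq_nonneg x) hp]
  rw [← htel, Finset.sum_mul, modeDissipation, Finset.mul_sum]
  refine (Finset.sum_le_sum fun i _ => hterm i).trans ?_
  refine Finset.sum_le_sum_of_subset_of_nonneg (fun i hi => ?_) fun i _ _ => by positivity
  rw [Finset.mem_range] at hi ⊢
  omega

/-- By Bernoulli, (1 + x)^{2(K+1)} ≥ 1 + 2m, so at least the fraction 2m/(1 + 2m) of the energy is
lost. -/
lemma energy_le_of_strong_damping {K : ℕ} {x a m : ℝ} (hx : 0 ≤ x) (ha : 0 ≤ a) (hm : 0 < m)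
    (h : m ≤ (K + 1) * x) : a ≤ (1 + 2 * m) / m * modeDissipation K x a := by
  have h1 := energy_loss_le (le_refl (K + 1)) hx ha
  have h2 : 1 + 2 * m ≤ (1 + x) ^ (2 * (K + 1)) := by
    have := one_add_mul_le_pow (by linarith : (-2 : ℝ) ≤ x) (2 * (K + 1))
    push_cast at this
    linarith
  have h3 : (1 / (1 + x)) ^ (2 * (K + 1)) ≤ 1 / (1 + 2 * m) := by
    rw [one_div_pow]
    exact one_div_le_one_div_of_le (by linarith) h2
  have h4 : (1 - 1 / (1 + 2 * m)) * a ≤ 2 * modeDissipation K x a :=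
    (mul_le_mul_of_nonneg_right (by linarith) ha).trans h1
  have h5 : 1 - 1 / (1 + 2 * m) = 2 * m / (1 + 2 * m) := by
    field_simp; ring
  rw [h5, div_mul_eq_mul_div, div_le_iff₀ (by linarith)] at h4
  rw [div_mul_eq_mul_div, le_div_iff₀ hm]
  linarith

end Damping

/-! ### Diagonalisation of the wave operator and of the norms. -/

variable {X : Type*} [NormedAddCommGroup X] [InnerProductSpace ℝ X]

lemma eigenvalue_pos {𝒜 : X →ₗ.[ℝ] X} (hpos : IsPositiveOp 𝒜) {φ : HilbertBasis ℕ ℝ X}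
    {η : ℕ → ℝ} (hφ : IsEigenbasis 𝒜 φ η) (j : ℕ) : 0 < η j := by
  obtain ⟨h, he⟩ := hφ.eigen j
  have hn : ‖φ j‖ = 1 := φ.orthonormal.1 j
  have := hpos ⟨φ j, h⟩ (by
    intro h0
    have : φ j = 0 := congrArg Subtype.val h0
    rw [this, norm_zero] at hn
    exact zero_ne_one hn)
  rwa [he, real_inner_smul_left, real_inner_self_eq_norm_sq, hn, one_pow, mul_one] at this

lemma inner_eigen [CompleteSpace X] {𝒜 : X →ₗ.[ℝ] X} (hsa : IsSelfAdjoint 𝒜)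
    {φ : HilbertBasis ℕ ℝ X} {η : ℕ → ℝ} (hφ : IsEigenbasis 𝒜 φ η) (j : ℕ) (x : 𝒜.domain) :
    ⟪φ j, 𝒜 x⟫_ℝ = η j * ⟪φ j, (x : X)⟫_ℝ := by
  obtain ⟨h, he⟩ := hφ.eigen j
  have hadj := LinearPMap.adjoint_isFormalAdjoint hsa.dense_domain
  rw [LinearPMap.isSelfAdjoint_def.1 hsa] at hadj
  have := hadj ⟨φ j, h⟩ x
  rw [he, real_inner_smul_left] at this
  exact this.symm

/-- The coordinate of `(w, v)` along the pair of eigenvectors of `A` for the frequencies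
`±√(η j)`. -/
def mode (φ : HilbertBasis ℕ ℝ X) (η : ℕ → ℝ) (j : ℕ) (z : X × X) : ℂ :=
  ⟨⟪φ j, z.2⟫_ℝ, √(η j) * ⟪φ j, z.1⟫_ℝ⟩

lemma mode_add (φ : HilbertBasis ℕ ℝ X) (η : ℕ → ℝ) (j : ℕ) (z z' : X × X) :
    mode φ η j (z + z') = mode φ η j z + mode φ η j z' := by
  apply Complex.ext <;> simp [mode, inner_add_right, mul_add]

lemma mode_smul (φ : HilbertBasis ℕ ℝ X) (η : ℕ → ℝ) (j : ℕ) (c : ℝ) (z : X × X) :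
    mode φ η j (c • z) = c * mode φ η j z := by
  apply Complex.ext <;> simp [mode, inner_smul_right]; ring

lemma mode_sub (φ : HilbertBasis ℕ ℝ X) (η : ℕ → ℝ) (j : ℕ) (z z' : X × X) :
    mode φ η j (z - z') = mode φ η j z - mode φ η j z' := by
  apply Complex.ext <;> simp [mode, inner_sub_right, mul_sub]

lemma norm_mode_sq {φ : HilbertBasis ℕ ℝ X} {η : ℕ → ℝ} {j : ℕ} (hη : 0 ≤ η j) (z : X × X) :
    ‖mode φ η j z‖ ^ 2 = η j * ⟪φ j, z.1⟫_ℝ ^ 2 + ⟪φ j, z.2⟫_ℝ ^ 2 := by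
  rw [← Complex.normSq_eq_norm_sq, Complex.normSq_apply, mode]
  nlinarith [Real.mul_self_sqrt hη]

section Wave

variable {𝒜 : X →ₗ.[ℝ] X} {φ : HilbertBasis ℕ ℝ X} {η : ℕ → ℝ}

lemma mode_waveApply [CompleteSpace X] (hsa : IsSelfAdjoint 𝒜) (hφ : IsEigenbasis 𝒜 φ η) {j : ℕ}
    (hη : 0 ≤ η j) {z : X × X} (hz : z ∈ (waveOp 𝒜 φ η).domain) :
    mode φ η j (waveApply 𝒜 φ η z) = Complex.I * √(η j) * mode φ η j z := by
  have e : waveApply 𝒜 φ η z = (z.2, -𝒜 ⟨z.1, hz.1⟩) := by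
    rw [waveApply, dif_pos hz]; rfl
  rw [e]
  apply Complex.ext
  · simp only [mode, inner_neg_right, inner_eigen hsa hφ]
    simp [← mul_assoc, Real.mul_self_sqrt hη]
  · simp [mode]

lemma waveApply_mem_energySpace {z : X × X} (hz : z ∈ (waveOp 𝒜 φ η).domain) :
    waveApply 𝒜 φ η z ∈ energySpace φ η := by
  have e : waveApply 𝒜 φ η z = (z.2, -𝒜 ⟨z.1, hz.1⟩) := by
    rw [waveApply, dif_pos hz]; rfl
  rw [e]
  exact ⟨hz.2, trivial⟩

lemma hasSum_inner_sq [CompleteSpace X] (φ : HilbertBasis ℕ ℝ X) (x : X) :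
    HasSum (fun j => ⟪φ j, x⟫_ℝ ^ 2) (‖x‖ ^ 2) := by
  have := φ.hasSum_inner_mul_inner x x
  rw [real_inner_self_eq_norm_sq] at this
  refine this.congr_fun fun j => ?_
  rw [real_inner_comm x (φ j)]
  ring

lemma hasSum_energy [CompleteSpace X] (hη : ∀ j, 0 < η j) {z : X × X}
    (hz : z ∈ energySpace φ η) :
    HasSum (fun j => ‖mode φ η j z‖ ^ 2) (energyNormSq φ η z) := by
  have h1 : Summable fun j => (η j ^ (1 / 2 : ℝ) * ⟪φ j, z.1⟫_ℝ) ^ 2 := hz.1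
  have h2 : powNorm φ η (1 / 2) z.1 ^ 2 = ∑' j, (η j ^ (1 / 2 : ℝ) * ⟪φ j, z.1⟫_ℝ) ^ 2 :=
    Real.sq_sqrt (tsum_nonneg fun j => sq_nonneg _)
  rw [energyNormSq, h2]
  refine (h1.hasSum.add (hasSum_inner_sq φ z.2)).congr_fun fun j => ?_
  rw [norm_mode_sq (hη j).le, mul_pow, ← Real.sqrt_eq_rpow, Real.sq_sqrt (hη j).le]

/-- Cauchy–Schwarz on partial sums. Only this direction is needed, as the weak norm stands on the
smaller side of the observability inequality. -/
lemma dualNorm_sq_le [CompleteSpace X] (hη : ∀ j, 0 < η j) {s : ℝ} {x : X}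
    (hx : Summable fun j => (η j ^ (-s) * ⟪φ j, x⟫_ℝ) ^ 2) :
    dualNorm φ η s x ^ 2 ≤ ∑' j, (η j ^ (-s) * ⟪φ j, x⟫_ℝ) ^ 2 := by
  have hle : dualNorm φ η s x ≤ √(∑' j, (η j ^ (-s) * ⟪φ j, x⟫_ℝ) ^ 2) := by
    refine Real.sSup_le ?_ (Real.sqrt_nonneg _)
    rintro r ⟨v, hv, hv1, rfl⟩
    have hv' : Summable fun j => (η j ^ s * ⟪φ j, v⟫_ℝ) ^ 2 := hv
    have hxv := φ.hasSum_inner_mul_inner x v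
    have hprod : ∀ j, ⟪x, φ j⟫_ℝ * ⟪φ j, v⟫_ℝ =
        (η j ^ (-s) * ⟪φ j, x⟫_ℝ) * (η j ^ s * ⟪φ j, v⟫_ℝ) := by
      intro j
      have : η j ^ (-s) * η j ^ s = 1 := by
        rw [← Real.rpow_add (hη j), neg_add_cancel, Real.rpow_zero]
      rw [real_inner_comm (φ j) x]
      calc _ = (η j ^ (-s) * η j ^ s) * (⟪φ j, x⟫_ℝ * ⟪φ j, v⟫_ℝ) := by rw [this, one_mul]
        _ = _ := by ring
    have hfin : ∀ t : Finset ℕ, |∑ j ∈ t, ⟪x, φ j⟫_ℝ * ⟪φ j, v⟫_ℝ| ≤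
        √(∑' j, (η j ^ (-s) * ⟪φ j, x⟫_ℝ) ^ 2) := by
      intro t
      simp_rw [hprod]
      have hcs := Finset.sum_mul_sq_le_sq_mul_sq t (fun j => η j ^ (-s) * ⟪φ j, x⟫_ℝ)
        (fun j => η j ^ s * ⟪φ j, v⟫_ℝ)
      refine Real.abs_le_sqrt (hcs.trans ?_)
      have e1 := hx.sum_le_tsum t fun j _ => sq_nonneg _
      have e2 := hv'.sum_le_tsum t fun j _ => sq_nonneg _
      have e3 : ∑' j, (η j ^ s * ⟪φ j, v⟫_ℝ) ^ 2 ≤ 1 := by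
        rwa [powNorm, Real.sqrt_le_one] at hv1
      have e4 : 0 ≤ ∑ j ∈ t, (η j ^ (-s) * ⟪φ j, x⟫_ℝ) ^ 2 :=
        Finset.sum_nonneg fun j _ => sq_nonneg _
      nlinarith
    exact le_of_tendsto (hxv.abs) (Filter.Eventually.of_forall fun t => hfin t)
  have h0 : 0 ≤ dualNorm φ η s x := by
    refine Real.sSup_nonneg ?_
    rintro r ⟨v, _, _, rfl⟩
    exact abs_nonneg _
  calc dualNorm φ η s x ^ 2 ≤ √(∑' j, (η j ^ (-s) * ⟪φ j, x⟫_ℝ) ^ 2) ^ 2 :=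
        pow_le_pow_left₀ h0 hle 2
    _ = _ := Real.sq_sqrt (tsum_nonneg fun j => sq_nonneg _)

lemma scaleNorm_sq_le [CompleteSpace X] (hη : ∀ j, 0 < η j) {σ : ℝ} {x : X}
    (hx : Summable fun j => (η j ^ σ * ⟪φ j, x⟫_ℝ) ^ 2) :
    scaleNorm φ η σ x ^ 2 ≤ ∑' j, (η j ^ σ * ⟪φ j, x⟫_ℝ) ^ 2 := by
  unfold scaleNorm
  split_ifs
  · exact (Real.sq_sqrt (tsum_nonneg fun j => sq_nonneg _)).le
  · have := dualNorm_sq_le (φ := φ) hη (s := -σ) (x := x) (by simpa using hx)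
    simpa using this

/-- Both components carry the same weight η_j^{-2β-1} on |mode|². It is largest at j = 0 because 2β
+ 1 > 0, so finite energy ensures summability, also when -β > 0. -/
lemma weakNormSq_le [CompleteSpace X] (hη : ∀ j, 0 < η j) (hmono : Monotone η) {β : ℝ}
    (hβ : -(1 / 2) < β) {z : X × X} (hz : z ∈ energySpace φ η) :
    (Summable fun j => (1 / √(η j) ^ (2 * β + 1)) ^ 2 * ‖mode φ η j z‖ ^ 2) ∧
      weakNormSq φ η β z ≤ ∑' j, (1 / √(η j) ^ (2 * β + 1)) ^ 2 * ‖mode φ η j z‖ ^ 2 := by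
  have hw : ∀ j, (1 / √(η j) ^ (2 * β + 1)) ^ 2 ≤ (1 / √(η 0) ^ (2 * β + 1)) ^ 2 := by
    intro j
    have h0 := Real.sqrt_pos.2 (hη 0)
    refine pow_le_pow_left₀ (by positivity) (one_div_le_one_div_of_le (by positivity) ?_) 2
    exact Real.rpow_le_rpow h0.le (Real.sqrt_le_sqrt (hmono (Nat.zero_le j))) (by linarith)
  have hsum : Summable fun j => (1 / √(η j) ^ (2 * β + 1)) ^ 2 * ‖mode φ η j z‖ ^ 2 := by
    refine Summable.of_nonneg_of_le (fun j => by positivity) (fun j => ?_)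
      ((hasSum_energy hη hz).summable.mul_left ((1 / √(η 0) ^ (2 * β + 1)) ^ 2))
    exact mul_le_mul_of_nonneg_right (hw j) (sq_nonneg _)
  have hsplit : ∀ j, (1 / √(η j) ^ (2 * β + 1)) ^ 2 * ‖mode φ η j z‖ ^ 2 =
      (η j ^ (-β) * ⟪φ j, z.1⟫_ℝ) ^ 2 + (η j ^ (-β - 1 / 2) * ⟪φ j, z.2⟫_ℝ) ^ 2 := by
    intro j
    have e1 : 1 / √(η j) ^ (2 * β + 1) = η j ^ (-β - 1 / 2) := by
      rw [Real.sqrt_eq_rpow, ← Real.rpow_mul (hη j).le, one_div, ← Real.rpow_neg (hη j).le]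
      congr 1
      ring
    have e2 : (η j ^ (-β)) ^ 2 = (η j ^ (-β - 1 / 2)) ^ 2 * η j := by
      have : η j ^ (-β) = η j ^ (-β - 1 / 2) * √(η j) := by
        rw [Real.sqrt_eq_rpow, ← Real.rpow_add (hη j)]
        congr 1
        ring
      rw [this, mul_pow, Real.sq_sqrt (hη j).le]
    rw [e1, norm_mode_sq (hη j).le, mul_pow, mul_pow, e2]
    ring
  refine ⟨hsum, ?_⟩
  simp_rw [hsplit] at hsum ⊢
  have s1 : Summable fun j => (η j ^ (-β) * ⟪φ j, z.1⟫_ℝ) ^ 2 :=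
    Summable.of_nonneg_of_le (fun j => sq_nonneg _)
      (fun j => le_add_of_nonneg_right (sq_nonneg _)) hsum
  have s2 : Summable fun j => (η j ^ (-β - 1 / 2) * ⟪φ j, z.2⟫_ℝ) ^ 2 :=
    Summable.of_nonneg_of_le (fun j => sq_nonneg _)
      (fun j => le_add_of_nonneg_left (sq_nonneg _)) hsum
  rw [s1.tsum_add s2]
  exact add_le_add (scaleNorm_sq_le hη s1) (scaleNorm_sq_le hη s2)

/-- The Cayley transform (1 + iα)/(1 - iα) equals e^{2i arctan α}. -/
lemma exp_phase (η Δt : ℝ) : Complex.exp (phase η Δt * Complex.I) *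
    (1 - (√η * Δt / 2 : ℝ) * Complex.I) = 1 + (√η * Δt / 2 : ℝ) * Complex.I := by
  set α := √η * Δt / 2 with hα
  have hs : 0 < √(1 + α ^ 2) := Real.sqrt_pos.2 (by positivity)
  have hexp : Complex.exp (Real.arctan α * Complex.I) =
      (1 + α * Complex.I) / (√(1 + α ^ 2) : ℝ) := by
    rw [Complex.exp_mul_I, ← Complex.ofReal_cos, ← Complex.ofReal_sin, Real.cos_arctan,
      Real.sin_arctan]
    push_cast
    ring
  have hsq : ((√(1 + α ^ 2) : ℝ) : ℂ) ^ 2 = 1 + (α : ℂ) ^ 2 := by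
    rw [← Complex.ofReal_pow, Real.sq_sqrt (by positivity)]
    push_cast
    ring
  have hne : (1 : ℂ) + (α : ℂ) ^ 2 ≠ 0 := by
    rw [← hsq, ← Complex.ofReal_pow]
    exact_mod_cast (pow_pos hs 2).ne'
  have h2 : Complex.exp (phase η Δt * Complex.I) = (1 + α * Complex.I) ^ 2 / (1 + (α : ℂ) ^ 2) := by
    rw [← hsq, ← div_pow, ← hexp, ← Complex.exp_nat_mul, phase, hα]
    congr 1
    push_cast
    ring
  have h3 : (1 + (α : ℂ) ^ 2) = (1 + α * Complex.I) * (1 - α * Complex.I) := by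
    ring_nf
    rw [Complex.I_sq]
    ring
  rw [h2, div_mul_eq_mul_div, div_eq_iff hne, h3]
  ring

lemma one_sub_mul_I_ne_zero (a : ℝ) : (1 : ℂ) - a * Complex.I ≠ 0 := by
  intro h
  have := congrArg Complex.re h
  simp at this

/-- On a mode `A²` is -η_j, so the implicit viscous step divides by 1 + Δt³ η_j; the midpoint step
is the Cayley rotation, and (e^{2i arctan α} + 1)/2 = 1/(1 - iα) yields the midpoint. -/
lemma mode_scheme [CompleteSpace X] (hsa : IsSelfAdjoint 𝒜) (hφ : IsEigenbasis 𝒜 φ η)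
    (hη : ∀ j, 0 < η j) {Δt : ℝ} (hΔ : 0 < Δt) {u v : ℕ → X × X}
    (h : IsSchemeSolution 𝒜 φ η Δt u v) (j k : ℕ) :
    mode φ η j (u k) = ((1 / (1 + Δt ^ 3 * η j)) ^ k : ℝ) *
      (Complex.exp ((k * phase (η j) Δt : ℝ) * Complex.I) * mode φ η j (u 0)) ∧
    mode φ η j ((1 / 2 : ℝ) • (v (k + 1) + u k)) =
      mode φ η j (u k) / (1 - (√(η j) * Δt / 2 : ℝ) * Complex.I) := by
  have hne := one_sub_mul_I_ne_zero (√(η j) * Δt / 2)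
  have hΔc : (Δt : ℂ) ≠ 0 := by exact_mod_cast hΔ.ne'
  have hv : ∀ k, mode φ η j (v (k + 1)) =
      Complex.exp (phase (η j) Δt * Complex.I) * mode φ η j (u k) := by
    intro k
    have e := congrArg (mode φ η j) (h.mid_eq k)
    rw [mode_waveApply hsa hφ (hη j).le (h.mid_mem k), mode_smul, mode_smul, mode_sub,
      mode_add] at e
    have e1 : mode φ η j (v (k + 1)) * (1 - (√(η j) * Δt / 2 : ℝ) * Complex.I) =
        (1 + (√(η j) * Δt / 2 : ℝ) * Complex.I) * mode φ η j (u k) := by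
      push_cast at e ⊢
      field_simp at e
      linear_combination (1 / 2 : ℂ) * e
    rw [← exp_phase] at e1
    have e2 : mode φ η j (v (k + 1)) * (1 - (√(η j) * Δt / 2 : ℝ) * Complex.I) =
        (Complex.exp (phase (η j) Δt * Complex.I) * mode φ η j (u k)) *
          (1 - (√(η j) * Δt / 2 : ℝ) * Complex.I) := by
      rw [e1]; ring
    exact mul_right_cancel₀ hne e2
  have hx : (1 : ℂ) + Δt ^ 3 * η j ≠ 0 := by
    have : 0 < 1 + Δt ^ 3 * η j := by have := hη j; positivity
    exact_mod_cast this.ne'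
  have hu : ∀ k, mode φ η j (u (k + 1)) =
      ((1 / (1 + Δt ^ 3 * η j) : ℝ) : ℂ) * mode φ η j (v (k + 1)) := by
    intro k
    have e := congrArg (mode φ η j) (h.next_eq k)
    rw [mode_smul, mode_smul, mode_sub, mode_waveApply hsa hφ (hη j).le (h.next_mem_sq k),
      mode_waveApply hsa hφ (hη j).le (h.next_mem k)] at e
    have hs : ((√(η j) : ℝ) : ℂ) ^ 2 = η j := by
      rw [← Complex.ofReal_pow, Real.sq_sqrt (hη j).le]
    have e3 : mode φ η j (u (k + 1)) * (1 + Δt ^ 3 * η j) = mode φ η j (v (k + 1)) := by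
      push_cast at e
      rw [div_mul_eq_mul_div, div_eq_iff hΔc] at e
      rw [← hs]
      linear_combination e + (Δt : ℂ) ^ 3 * ((√(η j) : ℝ) : ℂ) ^ 2 * mode φ η j (u (k + 1)) *
        Complex.I_sq
    push_cast
    rw [← e3]
    field_simp
  constructor
  · induction k with
    | zero => simp
    | succ k ih =>
      rw [hu, hv, ih]
      have : (((k + 1 : ℕ) : ℝ) * phase (η j) Δt : ℝ) * Complex.I =
          phase (η j) Δt * Complex.I + (k * phase (η j) Δt : ℝ) * Complex.I := by
        push_cast; ring
      rw [this, Complex.exp_add, pow_succ]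
      push_cast
      ring
  · rw [mode_smul, mode_add, hv, eq_div_iff hne]
    have := exp_phase (η j) Δt
    push_cast at this ⊢
    linear_combination (1 / 2 : ℂ) * mode φ η j (u k) * this

/-- The dissipation terms of the scheme are the sum of the dissipations of the modes. -/
lemma hasSum_dissipation [CompleteSpace X] (hsa : IsSelfAdjoint 𝒜) (hφ : IsEigenbasis 𝒜 φ η)
    (hη : ∀ j, 0 < η j) {Δt : ℝ} (hΔ : 0 < Δt) {u v : ℕ → X × X}
    (h : IsSchemeSolution 𝒜 φ η Δt u v) (K : ℕ) :
    HasSum (fun j => modeDissipation K (Δt ^ 3 * η j) (‖mode φ η j (u 0)‖ ^ 2))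
      (Δt * ∑ k ∈ Finset.range (K + 1), Δt ^ 2 * energyNormSq φ η (waveApply 𝒜 φ η (u (k + 1)))
      + Δt * ∑ k ∈ Finset.range (K + 1),
        Δt ^ 5 * energyNormSq φ η (waveApply 𝒜 φ η (waveApply 𝒜 φ η (u (k + 1))))) := by
  have h1 := fun k => hasSum_energy hη (waveApply_mem_energySpace (h.next_mem k))
  have h2 := fun k => hasSum_energy hη (waveApply_mem_energySpace (h.next_mem_sq k))
  have H := ((hasSum_sum fun k (_ : k ∈ Finset.range (K + 1)) =>
    (h1 k).mul_left (Δt ^ 2)).mul_left Δt).add ((hasSum_sum fun k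
      (_ : k ∈ Finset.range (K + 1)) => (h2 k).mul_left (Δt ^ 5)).mul_left Δt)
  refine H.congr_fun fun j => ?_
  rw [modeDissipation, Finset.mul_sum, Finset.mul_sum, ← Finset.sum_add_distrib]
  refine Finset.sum_congr rfl fun k _ => ?_
  have hn : ‖Complex.I * ((√(η j) : ℝ) : ℂ)‖ ^ 2 = η j := by
    rw [norm_mul, Complex.norm_I, one_mul, Complex.norm_real, Real.norm_eq_abs, sq_abs,
      Real.sq_sqrt (hη j).le]
  have hu : ‖mode φ η j (u (k + 1))‖ ^ 2 =
      (1 / (1 + Δt ^ 3 * η j)) ^ (2 * (k + 1)) * ‖mode φ η j (u 0)‖ ^ 2 := by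
    rw [(mode_scheme hsa hφ hη hΔ h j (k + 1)).1, norm_mul, norm_mul,
      Complex.norm_exp_ofReal_mul_I, Complex.norm_real, Real.norm_eq_abs, one_mul, mul_pow,
      sq_abs, ← pow_mul, mul_comm (k + 1) 2]
  have e1 : ‖mode φ η j (waveApply 𝒜 φ η (u (k + 1)))‖ ^ 2 =
      η j * ‖mode φ η j (u (k + 1))‖ ^ 2 := by
    rw [mode_waveApply hsa hφ (hη j).le (h.next_mem k), norm_mul, mul_pow, hn]
  have e2 : ‖mode φ η j (waveApply 𝒜 φ η (waveApply 𝒜 φ η (u (k + 1))))‖ ^ 2 =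
      η j * (η j * ‖mode φ η j (u (k + 1))‖ ^ 2) := by
    rw [mode_waveApply hsa hφ (hη j).le (h.next_mem_sq k), norm_mul, mul_pow, hn, e1]
  rw [e2, e1, hu]
  ring

end Wave

/-! ### The weakened observability inequality -/

/-- Linear growth of the frequencies; it makes the low frequency part finite. -/
lemma two_mul_le_sqrt {η : ℕ → ℝ} {γ₁ : ℝ} (hgap : WeakGap (freq η) γ₁) (n : ℕ) :
    n * (2 * γ₁) ≤ √(η (2 * n)) := by
  induction n with
  | zero => simp
  | succ n ih =>
    have h : 2 * γ₁ ≤ √(η (2 * (n + 1))) - √(η (2 * n)) := hgap ((2 * n : ℕ) : ℤ)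
    push_cast
    linarith

lemma exists_low_frequency_bound {η : ℕ → ℝ} (hη : Monotone η) {γ₁ : ℝ} (hγ : 0 < γ₁)
    (hgap : WeakGap (freq η) γ₁) (r : ℝ) :
    ∃ N : ℕ, (∀ j < N, √(η j) ≤ r) ∧ ∀ j, N ≤ j → r < √(η j) := by
  classical
  have hex : ∃ j, r < √(η j) := by
    obtain ⟨n, hn⟩ := exists_nat_gt (r / (2 * γ₁))
    rw [div_lt_iff₀ (by positivity)] at hn
    exact ⟨2 * n, hn.trans_le (two_mul_le_sqrt hgap n)⟩
  refine ⟨Nat.find hex, fun j hj => not_lt.1 (Nat.find_min hex hj), fun j hj => ?_⟩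
  exact (Nat.find_spec hex).trans_le (Real.sqrt_le_sqrt (hη hj))

section

variable {X Y : Type*} [NormedAddCommGroup X] [InnerProductSpace ℝ X] [CompleteSpace X]
  [NormedAddCommGroup Y] [InnerProductSpace ℝ Y] [CompleteSpace Y]
  {𝒜 : X →ₗ.[ℝ] X} {φ : HilbertBasis ℕ ℝ X} {η : ℕ → ℝ}

/-- In each step, the second component of the midpoint of the viscous scheme differs from the low
frequency part of the conservative scheme by at most the total dissipation. -/
lemma norm_sq_midpoint_sub_le (hsa : IsSelfAdjoint 𝒜) (hφ : IsEigenbasis 𝒜 φ η)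
    (hη : ∀ j, 0 < η j) {Δt : ℝ} (hΔ : 0 < Δt) {u v : ℕ → X × X}
    (h : IsSchemeSolution 𝒜 φ η Δt u v) {K k N : ℕ} (hk : k ≤ K) {C : ℝ} (hC : 2 ≤ C)
    (hhigh : ∀ j, N ≤ j → ‖mode φ η j (u 0)‖ ^ 2 ≤
      C * modeDissipation K (Δt ^ 3 * η j) (‖mode φ η j (u 0)‖ ^ 2)) :
    ‖((1 / 2 : ℝ) • (v (k + 1) + u k)).2 - ∑ j ∈ Finset.range N,
        (Complex.exp ((k * phase (η j) Δt : ℝ) * Complex.I) *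
          (mode φ η j (u 0) / (1 - (√(η j) * Δt / 2 : ℝ) * Complex.I))).re • φ j‖ ^ 2 ≤
      C * ∑' j, modeDissipation K (Δt ^ 3 * η j) (‖mode φ η j (u 0)‖ ^ 2) := by
  set D : ℕ → ℝ := fun j => modeDissipation K (Δt ^ 3 * η j) (‖mode φ η j (u 0)‖ ^ 2) with hD
  have hDs : Summable D := (hasSum_dissipation hsa hφ hη hΔ h K).summable
  have hx : ∀ j, 0 ≤ Δt ^ 3 * η j := fun j => by have := hη j; positivity
  have hD0 : ∀ j, 0 ≤ D j := fun j => modeDissipation_nonneg K (hx j) (sq_nonneg _)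
  set w : ℕ → ℂ := fun j => Complex.exp ((k * phase (η j) Δt : ℝ) * Complex.I) *
    (mode φ η j (u 0) / (1 - (√(η j) * Δt / 2 : ℝ) * Complex.I)) with hw
  have hwn : ∀ j, (w j).re ^ 2 ≤ ‖mode φ η j (u 0)‖ ^ 2 := by
    intro j
    have h1 : (1 : ℝ) ≤ ‖(1 : ℂ) - (√(η j) * Δt / 2 : ℝ) * Complex.I‖ := by
      have := Complex.abs_re_le_norm ((1 : ℂ) - (√(η j) * Δt / 2 : ℝ) * Complex.I)
      simpa using this
    have h2 : ‖w j‖ ≤ ‖mode φ η j (u 0)‖ := by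
      rw [hw]
      simp only
      rw [norm_mul, Complex.norm_exp_ofReal_mul_I, one_mul, norm_div]
      exact div_le_self (norm_nonneg _) h1
    rw [← sq_abs]
    exact pow_le_pow_left₀ (abs_nonneg _) ((Complex.abs_re_le_norm _).trans h2) 2
  have hmid : ∀ j, ⟪φ j, ((1 / 2 : ℝ) • (v (k + 1) + u k)).2⟫_ℝ =
      (1 / (1 + Δt ^ 3 * η j)) ^ k * (w j).re := by
    intro j
    obtain ⟨e1, e2⟩ := mode_scheme hsa hφ hη hΔ h j k
    change (mode φ η j ((1 / 2 : ℝ) • (v (k + 1) + u k))).re = _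
    rw [e2, e1, ← Complex.re_ofReal_mul]
    congr 1
    simp only [hw]
    ring
  have hcoef : ∀ j, ⟪φ j, ∑ i ∈ Finset.range N, (w i).re • φ i⟫_ℝ =
      if j < N then (w j).re else 0 := by
    intro j
    rw [inner_sum]
    simp only [real_inner_smul_right, orthonormal_iff_ite.1 φ.orthonormal]
    simp
  refine (hasSum_le (fun j => ?_) (hasSum_inner_sq φ _) (hDs.hasSum.mul_left C))
  rw [inner_sub_right, hmid, hcoef]
  set r := 1 / (1 + Δt ^ 3 * η j) with hr
  have hr0 : 0 ≤ r := by have := hx j; positivity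
  have hr1 : r ≤ 1 := by
    rw [hr, div_le_one (by have := hx j; positivity)]
    linarith [hx j]
  have hrk0 : 0 ≤ r ^ k := pow_nonneg hr0 k
  have hrk1 : r ^ k ≤ 1 := pow_le_one₀ hr0 hr1
  split_ifs with hj
  · have hloss := energy_loss_le (k := k) (by omega : k ≤ K + 1) (hx j)
      (sq_nonneg ‖mode φ η j (u 0)‖)
    have e1 : (r ^ k * (w j).re - (w j).re) ^ 2 = (1 - r ^ k) ^ 2 * (w j).re ^ 2 := by ring
    -- (1 - s)² ≤ 1 - s² for s in [0, 1]: the squared amplitude error of a low mode is at most its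
    -- energy loss.
    have e2 : (1 - r ^ k) ^ 2 ≤ 1 - r ^ (2 * k) := by
      rw [mul_comm, pow_mul]
      nlinarith
    have e3 := mul_le_mul e2 (hwn j) (sq_nonneg _) ((sq_nonneg _).trans e2)
    have e4 : 2 * D j ≤ C * D j := mul_le_mul_of_nonneg_right hC (hD0 j)
    rw [e1]
    exact e3.trans (hloss.trans e4)
  · have e1 : (r ^ k * (w j).re - 0) ^ 2 = (r ^ k) ^ 2 * (w j).re ^ 2 := by ring
    rw [e1]
    refine le_trans ?_ (hhigh j (not_lt.1 hj))
    exact (mul_le_of_le_one_left (sq_nonneg _) (pow_le_one₀ hrk0 hrk1)).trans (hwn j)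

lemma modeObs_natCast (𝓑 : Y →L[ℝ] X) (φ : HilbertBasis ℕ ℝ X) (j : ℕ) :
    modeObs 𝓑 φ (j : ℤ) = ContinuousLinearMap.adjoint 𝓑 ((1 / √2 : ℝ) • φ j) := rfl

lemma modeObs_negSucc (𝓑 : Y →L[ℝ] X) (φ : HilbertBasis ℕ ℝ X) (j : ℕ) :
    modeObs 𝓑 φ (Int.negSucc j) = modeObs 𝓑 φ (j : ℤ) := rfl

/-- The factor 2 in ‖a - b‖² ≤ 2‖a‖² + 2‖b‖² is absorbed by the normalisation 1/√2 of the
eigenvectors. -/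
lemma norm_sum_modeObs_sq_le (𝓑 : Y →L[ℝ] X) (φ : HilbertBasis ℕ ℝ X) (N : ℕ) (a : ℕ → ℝ)
    (z : X × X) : ‖∑ j ∈ Finset.range N, a j • modeObs 𝓑 φ j‖ ^ 2 ≤
      ‖obs 𝓑 z‖ ^ 2 + ‖𝓑‖ ^ 2 * ‖z.2 - ∑ j ∈ Finset.range N, a j • φ j‖ ^ 2 := by
  set s := ∑ j ∈ Finset.range N, a j • φ j with hs
  have e : ∑ j ∈ Finset.range N, a j • modeObs 𝓑 φ j =
      (1 / √2 : ℝ) • (obs 𝓑 z - ContinuousLinearMap.adjoint 𝓑 (z.2 - s)) := by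
    rw [obs, ← map_sub, sub_sub_cancel, hs, map_sum, Finset.smul_sum]
    refine Finset.sum_congr rfl fun j _ => ?_
    rw [modeObs_natCast, map_smul, map_smul, smul_comm]
  have h2 : (1 / √2 : ℝ) ^ 2 = 1 / 2 := by
    rw [div_pow, Real.sq_sqrt (by norm_num), one_pow]
  have h3 : ‖ContinuousLinearMap.adjoint 𝓑 (z.2 - s)‖ ^ 2 ≤ ‖𝓑‖ ^ 2 * ‖z.2 - s‖ ^ 2 := by
    rw [← mul_pow]
    refine pow_le_pow_left₀ (norm_nonneg _) ?_ 2
    have := (ContinuousLinearMap.adjoint 𝓑).le_opNorm (z.2 - s)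
    rwa [LinearIsometryEquiv.norm_map] at this
  have h4 := parallelogram_law_with_norm ℝ (obs 𝓑 z) (ContinuousLinearMap.adjoint 𝓑 (z.2 - s))
  rw [e, norm_smul, mul_pow, Real.norm_eq_abs, sq_abs, h2]
  nlinarith [mul_self_nonneg ‖obs 𝓑 z + ContinuousLinearMap.adjoint 𝓑 (z.2 - s)‖]

/-- The high frequencies are controlled by the dissipation. -/
lemma high_frequency_le {T Δt δ : ℝ} (hT : 0 < T) (hΔ : 0 < Δt) (hδ : 0 < δ)
    {e a : ℝ} (he : 0 ≤ e) (ha : 0 ≤ a) (hhigh : δ / Δt < √e) :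
    a ≤ (1 + 2 * (δ ^ 2 * T)) / (δ ^ 2 * T) * modeDissipation ⌊T / Δt⌋₊ (Δt ^ 3 * e) a := by
  refine energy_le_of_strong_damping (by positivity) ha (by positivity) ?_
  have h1 : T / Δt < ⌊T / Δt⌋₊ + 1 := Nat.lt_floor_add_one _
  rw [div_lt_iff₀ hΔ] at h1 hhigh
  -- Thus x = Δt³ e ≥ δ² Δt, and the K + 1 steps cover a time of at least T, so the accumulated
  -- damping is at least δ²T, uniformly in Δt.
  have h2 : δ ^ 2 ≤ Δt ^ 2 * e := by
    have := pow_le_pow_left₀ hδ.le hhigh.le 2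
    rw [mul_pow, Real.sq_sqrt he] at this
    linarith
  calc δ ^ 2 * T ≤ (Δt ^ 2 * e) * ((⌊T / Δt⌋₊ + 1) * Δt) :=
        mul_le_mul h2 h1.le hT.le (by positivity)
    _ = (⌊T / Δt⌋₊ + 1) * (Δt ^ 3 * e) := by ring

theorem weakObservability_of_clusterBound (hsa : IsSelfAdjoint 𝒜) (hφ : IsEigenbasis 𝒜 φ η)
    (hη : ∀ j, 0 < η j) (𝓑 : Y →L[ℝ] X) {β : ℝ} (hβ : -(1 / 2) < β) {γ₁ : ℝ} (hγ : 0 < γ₁)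
    (hgap : WeakGap (freq η) γ₁) (hbound : ClusterBound 𝓑 φ η β γ₁) :
    WeakObservability 𝒜 φ η 𝓑 β (2 * (2 * Real.pi / γ₁)) := by
  obtain ⟨θ, hθ, hone, htwo⟩ := hbound
  have hpi := Real.pi_pos
  have hp : 0 ≤ 2 * β + 1 := by linarith
  have hmono := hφ.mono
  have hμ : 0 < √(η 0) := Real.sqrt_pos.2 (hη 0)
  set T := 2 * (2 * Real.pi / γ₁) with hT
  have hTpos : 0 < T := by positivity
  -- As soon as one low mode exists, √η_0 Δt ≤ δ; this choice then yields γ₁Δt ≤ 1, Δt ≤ 1/√η_0, and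
  -- √η_j Δt ≤ 1 for all low modes.
  set δ := min 1 (√(η 0) / γ₁) with hδ
  have hδpos : 0 < δ := lt_min one_pos (by positivity)
  obtain ⟨C₁, hC₁⟩ : ∃ C₁, C₁ = 2 + (1 + 2 * (δ ^ 2 * T)) / (δ ^ 2 * T) := ⟨_, rfl⟩
  have hC₁2 : 2 ≤ C₁ := by
    have : 0 ≤ (1 + 2 * (δ ^ 2 * T)) / (δ ^ 2 * T) := by positivity
    linarith
  have hC₁pos : 0 < C₁ := by linarith
  obtain ⟨C₂, hC₂⟩ : ∃ C₂, C₂ = 3 * (1 + γ₁ ^ 2) / θ ^ 2 *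
    (3 * (9 / 2 * Real.pi * (3 * γ₁ / (4 * Real.pi) * 4))) := ⟨_, rfl⟩
  have hC₂pos : 0 < C₂ := by rw [hC₂]; positivity
  obtain ⟨w₀, hw₀⟩ : ∃ w₀, w₀ = (1 / √(η 0) ^ (2 * β + 1)) ^ 2 := ⟨_, rfl⟩
  have hw₀pos : 0 < w₀ := by rw [hw₀]; positivity
  -- T + 1/√η_0 bounds (K + 1)Δt, so the stepwise error sums to a multiple of the dissipation.
  obtain ⟨C₃, hC₃⟩ : ∃ C₃, C₃ = (T + 1 / √(η 0)) * (‖𝓑‖ ^ 2 * C₁) := ⟨_, rfl⟩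
  have hC₃nonneg : 0 ≤ C₃ := by rw [hC₃]; positivity
  obtain ⟨C, hC⟩ : ∃ C, C = 2 * C₂ * (1 + C₃) + w₀ * C₁ := ⟨_, rfl⟩
  have hCpos : 0 < C := by rw [hC]; positivity
  refine ⟨1 / C, by positivity, fun Δt hΔ u v hsol => ?_⟩
  set K := ⌊T / Δt⌋₊ with hK
  obtain ⟨N, hlow, hhigh⟩ := exists_low_frequency_bound hmono hγ hgap (δ / Δt)
  set D : ℕ → ℝ := fun j => modeDissipation K (Δt ^ 3 * η j) (‖mode φ η j (u 0)‖ ^ 2) with hD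
  have hx : ∀ j, 0 ≤ Δt ^ 3 * η j := fun j => by have := hη j; positivity
  have hD0 : ∀ j, 0 ≤ D j := fun j => modeDissipation_nonneg K (hx j) (sq_nonneg _)
  have hDsum := hasSum_dissipation hsa hφ hη hΔ hsol K
  rw [add_assoc, ← hDsum.tsum_eq]
  set S := ∑' j, D j with hS
  set O := Δt * ∑ k ∈ Finset.range (K + 1), ‖obs 𝓑 ((1 / 2 : ℝ) • (v (k + 1) + u k))‖ ^ 2 with hO
  have hS0 : 0 ≤ S := tsum_nonneg hD0
  have hO0 : 0 ≤ O := by positivity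
  have hhigh' : ∀ j, N ≤ j → ‖mode φ η j (u 0)‖ ^ 2 ≤ C₁ * D j := by
    intro j hj
    have := high_frequency_le hTpos hΔ hδpos (hη j).le (sq_nonneg ‖mode φ η j (u 0)‖) (hhigh j hj)
    refine this.trans (mul_le_mul_of_nonneg_right ?_ (hD0 j))
    rw [hC₁]
    linarith
  obtain ⟨hWs, hWle⟩ := weakNormSq_le hη hmono hβ hsol.init_mem
  have hlowsum : ∑ j ∈ Finset.range N, (1 / √(η j) ^ (2 * β + 1)) ^ 2 * ‖mode φ η j (u 0)‖ ^ 2 ≤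
      2 * C₂ * (O + C₃ * S) := by
    -- If there is no low mode, as for large Δt, dissipation alone suffices; this removes any upper
    -- bound on Δt.
    rcases N.eq_zero_or_pos with rfl | hN
    · rw [Finset.sum_range_zero]; positivity
    have hΔμ : Δt * √(η 0) ≤ δ := by
      have := hlow 0 hN
      rwa [le_div_iff₀ hΔ, mul_comm] at this
    have hΔ₀ : Δt ≤ 1 / √(η 0) := by
      rw [le_div_iff₀ hμ]
      exact hΔμ.trans (min_le_left _ _)
    have hΔγ : γ₁ * Δt ≤ 1 := by
      have := hΔμ.trans (min_le_right _ _)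
      rw [le_div_iff₀ hγ] at this
      nlinarith
    have hNlow : ∀ j < N, √(η j) * Δt ≤ 1 := by
      intro j hj
      have := hlow j hj
      rw [le_div_iff₀ hΔ] at this
      exact this.trans (min_le_left _ _)
    have hcons := low_frequency_observability hη hmono hγ hgap hp hθ (b := modeObs 𝓑 φ)
      (modeObs_negSucc 𝓑 φ) hone htwo hΔ hΔγ hNlow
      (fun j => mode φ η j (u 0) / (1 - (√(η j) * Δt / 2 : ℝ) * Complex.I))
    -- Passing to the midpoint divides the amplitude by 1 - iα, and |1 - iα|² ≤ 2 at low frequency.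
    have hleft : ∀ j ∈ Finset.range N,
        (1 / √(η j) ^ (2 * β + 1)) ^ 2 * ‖mode φ η j (u 0)‖ ^ 2 ≤
        2 * ((1 / √(η j) ^ (2 * β + 1)) ^ 2 *
          ‖mode φ η j (u 0) / (1 - (√(η j) * Δt / 2 : ℝ) * Complex.I)‖ ^ 2) := by
      intro j hj
      have hα := hNlow j (Finset.mem_range.1 hj)
      have hα0 : 0 ≤ √(η j) * Δt := by positivity
      have hden : ‖(1 : ℂ) - (√(η j) * Δt / 2 : ℝ) * Complex.I‖ ^ 2 =
          1 + (√(η j) * Δt / 2) ^ 2 := by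
        rw [← Complex.normSq_eq_norm_sq, Complex.normSq_apply]
        simp only [Complex.sub_re, Complex.one_re, Complex.mul_re, Complex.ofReal_re,
          Complex.I_re, Complex.ofReal_im, Complex.I_im, Complex.sub_im, Complex.one_im,
          Complex.mul_im]
        ring
      have hq : ‖mode φ η j (u 0)‖ ^ 2 ≤
          2 * (‖mode φ η j (u 0)‖ ^ 2 / (1 + (√(η j) * Δt / 2) ^ 2)) := by
        have hα2 : (√(η j) * Δt / 2) ^ 2 ≤ 1 := pow_le_one₀ (by positivity) (by linarith)
        rw [mul_div_assoc', le_div_iff₀ (by positivity), mul_comm]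
        exact mul_le_mul_of_nonneg_right (by linarith) (sq_nonneg _)
      rw [norm_div, div_pow ‖mode φ η j (u 0)‖, hden]
      have hw : 0 ≤ (1 / √(η j) ^ (2 * β + 1)) ^ 2 := sq_nonneg _
      nlinarith [mul_le_mul_of_nonneg_left hq hw]
    have hobs : Δt * ∑ k ∈ Finset.range (K + 1), ‖∑ j ∈ Finset.range N,
        (Complex.exp ((k * phase (η j) Δt : ℝ) * Complex.I) *
          (mode φ η j (u 0) / (1 - (√(η j) * Δt / 2 : ℝ) * Complex.I))).re •
            modeObs 𝓑 φ j‖ ^ 2 ≤ O + C₃ * S := by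
      have hk : ∀ k ∈ Finset.range (K + 1), ‖∑ j ∈ Finset.range N,
          (Complex.exp ((k * phase (η j) Δt : ℝ) * Complex.I) *
            (mode φ η j (u 0) / (1 - (√(η j) * Δt / 2 : ℝ) * Complex.I))).re •
              modeObs 𝓑 φ j‖ ^ 2 ≤
          ‖obs 𝓑 ((1 / 2 : ℝ) • (v (k + 1) + u k))‖ ^ 2 + ‖𝓑‖ ^ 2 * (C₁ * S) := by
        intro k hk
        refine (norm_sum_modeObs_sq_le 𝓑 φ N _ ((1 / 2 : ℝ) • (v (k + 1) + u k))).trans ?_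
        have := norm_sq_midpoint_sub_le hsa hφ hη hΔ hsol
          (Nat.lt_succ_iff.1 (Finset.mem_range.1 hk)) hC₁2 hhigh'
        gcongr
      have hKΔ : Δt * (K + 1) ≤ T + 1 / √(η 0) := by
        have : (K : ℝ) ≤ T / Δt := Nat.floor_le (by positivity)
        rw [le_div_iff₀ hΔ] at this
        linarith
      refine (mul_le_mul_of_nonneg_left (Finset.sum_le_sum hk) hΔ.le).trans ?_
      rw [Finset.sum_add_distrib, Finset.sum_const, Finset.card_range, nsmul_eq_mul, mul_add]
      refine add_le_add le_rfl ?_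
      have hb : 0 ≤ ‖𝓑‖ ^ 2 * (C₁ * S) := by positivity
      have := mul_le_mul_of_nonneg_right hKΔ hb
      push_cast
      rw [hC₃]
      linarith
    calc _ ≤ 2 * ∑ j ∈ Finset.range N, ((1 / √(η j) ^ (2 * β + 1)) ^ 2 *
          ‖mode φ η j (u 0) / (1 - (√(η j) * Δt / 2 : ℝ) * Complex.I)‖ ^ 2) := by
            rw [Finset.mul_sum]; exact Finset.sum_le_sum hleft
      _ ≤ 2 * (C₂ * (O + C₃ * S)) := by
            rw [← hC₂] at hcons
            refine mul_le_mul_of_nonneg_left (hcons.trans ?_) zero_le_two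
            exact mul_le_mul_of_nonneg_left hobs hC₂pos.le
      _ = 2 * C₂ * (O + C₃ * S) := by ring
  have hhighsum : ∑' j, (1 / √(η (j + N)) ^ (2 * β + 1)) ^ 2 * ‖mode φ η (j + N) (u 0)‖ ^ 2 ≤
      w₀ * C₁ * S := by
    have hsh := (summable_nat_add_iff N).2 hDsum.summable
    have hle : ∑' j, D (j + N) ≤ S := by
      rw [hS, ← hDsum.summable.sum_add_tsum_nat_add N]
      exact le_add_of_nonneg_left (Finset.sum_nonneg fun j _ => hD0 j)
    refine le_trans ?_ (mul_le_mul_of_nonneg_left hle (by positivity))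
    rw [← tsum_mul_left]
    refine ((summable_nat_add_iff N).2 hWs).tsum_le_tsum (fun j => ?_) (hsh.mul_left _)
    have hw : (1 / √(η (j + N)) ^ (2 * β + 1)) ^ 2 ≤ w₀ := by
      rw [hw₀]
      refine pow_le_pow_left₀ (by positivity) (one_div_le_one_div_of_le (by positivity) ?_) 2
      exact Real.rpow_le_rpow hμ.le (Real.sqrt_le_sqrt (hmono (Nat.zero_le _))) hp
    calc _ ≤ w₀ * (C₁ * D (j + N)) :=
          mul_le_mul hw (hhigh' _ (Nat.le_add_left _ _)) (sq_nonneg _) (by positivity)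
      _ = _ := by ring
  have htotal : weakNormSq φ η β (u 0) ≤ C * (O + S) := by
    refine hWle.trans ?_
    rw [← hWs.sum_add_tsum_nat_add N]
    have h0 : 0 ≤ 2 * (C₂ * (C₃ * O)) + 2 * (C₂ * S) + w₀ * C₁ * O := by positivity
    have h1 : C * (O + S) = 2 * C₂ * (O + C₃ * S) + w₀ * C₁ * S +
        (2 * (C₂ * (C₃ * O)) + 2 * (C₂ * S) + w₀ * C₁ * O) := by rw [hC]; ring
    rw [h1]
    exact (add_le_add hlowsum hhighsum).trans (le_add_of_nonneg_right h0)
  rw [div_mul_eq_mul_div, one_mul, div_le_iff₀ hCpos, mul_comm]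
  exact htotal

lemma gap_succ_of_uniformGap (hmono : Monotone η) {γ : ℝ}
    (h : UniformGap (freq η) γ) : ∀ n, γ ≤ freq η (n + 1) - freq η n := by
  intro n
  have := h (n + 1) n (by omega)
  rwa [abs_of_nonneg (sub_nonneg.2 (freq_le_succ hmono n))] at this

/-- With consecutive gaps of at least γ there are no pairs, so only the condition on single modes
remains. -/
lemma clusterBound_of_modeBound {𝓑 : Y →L[ℝ] X} {β γ : ℝ}
    (hstep : ∀ n, γ ≤ freq η (n + 1) - freq η n) (h : ModeBound 𝓑 φ η β) :
    ClusterBound 𝓑 φ η β γ := by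
  obtain ⟨θ, hθ, hb⟩ := h
  have hmode : ∀ n : ℤ, θ / |freq η n| ^ (2 * β + 1) ≤ ‖modeObs 𝓑 φ n‖ := by
    rintro (n | n)
    · have := hb n
      rwa [← abs_of_nonneg (a := freq η n) (Real.sqrt_nonneg (η n))] at this
    · have := hb n
      rwa [freq_negSucc, abs_neg, abs_of_nonneg (Real.sqrt_nonneg _)]
  refine ⟨θ, hθ, fun n _ ξ => ?_, fun n hn => absurd (hstep n) (not_le.2 hn.2.1)⟩
  have e1 : clusterNorm clusterMatrixOne ![modeObs 𝓑 φ n] ξ = ‖modeObs 𝓑 φ n‖ * ‖ξ‖ := by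
    rw [EuclideanSpace.norm_eq, clusterNorm]
    simp [clusterMatrixOne, norm_smul, mul_comm, Real.sqrt_sq_eq_abs, abs_mul]
  rw [e1]
  exact mul_le_mul_of_nonneg_right (hmode n) (norm_nonneg _)

end

end TimeDiscreteWave

end

theorem lemma2p1 {X Y : Type*}
    [NormedAddCommGroup X] [InnerProductSpace ℝ X] [CompleteSpace X]
    [NormedAddCommGroup Y] [InnerProductSpace ℝ Y] [CompleteSpace Y]
    (𝒜 : X →ₗ.[ℝ] X) (hsa : IsSelfAdjoint 𝒜)
    (hpos : TimeDiscreteWave.IsPositiveOp 𝒜)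
    (hinv : TimeDiscreteWave.HasCompactInverse 𝒜)
    (φ : HilbertBasis ℕ ℝ X) (η : ℕ → ℝ)
    (hφ : TimeDiscreteWave.IsEigenbasis 𝒜 φ η)
    (𝓑 : Y →L[ℝ] X) (β : ℝ) (hβ : -(1 / 2) < β) :
    (∀ γ : ℝ, 0 < γ →
      TimeDiscreteWave.UniformGap (TimeDiscreteWave.freq η) γ →
      TimeDiscreteWave.ModeBound 𝓑 φ η β →
      TimeDiscreteWave.WeakObservability 𝒜 φ η 𝓑 β (2 * (2 * Real.pi / γ))) ∧
    (∀ γ₁ : ℝ, 0 < γ₁ →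
      TimeDiscreteWave.WeakGap (TimeDiscreteWave.freq η) γ₁ →
      TimeDiscreteWave.ClusterBound 𝓑 φ η β γ₁ →
      TimeDiscreteWave.WeakObservability 𝒜 φ η 𝓑 β (2 * (2 * Real.pi / γ₁))) := by
  have hη := TimeDiscreteWave.eigenvalue_pos hpos hφ
  refine ⟨fun γ hγ hgap hmode => ?_, fun γ₁ hγ hgap hbound =>
    TimeDiscreteWave.weakObservability_of_clusterBound hsa hφ hη 𝓑 hβ hγ hgap hbound⟩
  have hstep := TimeDiscreteWave.gap_succ_of_uniformGap hφ.mono hgap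
  refine TimeDiscreteWave.weakObservability_of_clusterBound hsa hφ hη 𝓑 hβ hγ (fun n => ?_)
    (TimeDiscreteWave.clusterBound_of_modeBound hstep hmode)
  have h1 := hstep n
  have h2 := hstep (n + 1)
  rw [show n + 1 + 1 = n + 2 by ring] at h2
  linarith
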